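/- Let $q\ge 3$ be an integer. For a finite graph $G=(V,E)$ and $w\ge 0$, the Gibbs measure of the $q$-state anti-ferromagnetic Potts model gives a coloring $\phi:V\to\{1,\dots,q\}$ the probability $$\mathrm{Pr}_{G;q,w}[\mathbf\Phi=\phi]=\frac{w^{m(\phi)}}{\sum_{\sigma:V\to\{1,\dots,q\}}w^{m(\sigma)}},$$ where $m(\phi)$ is the number of edges $\{u,v\}\in E$ with $\phi(u)=\phi(v)$. For integers $d\ge 1$ and $n\ge 0$ let $\mathbb T^n_{d+1}$ be the finite rooted tree with root $r$ in which every vertex at distance less than $n$ from $r$ has exactly $d$ children and there are no vertices at distance more than $n$ from $r$ (that is, take the infinite $(d+1)$-regular tree with root $r$, delete one neighbor of $r$ and all vertices at distance more than $n$ from $r$, and keep the component of $r$). Let $\Lambda_n$ be the set of its vertices at distance $n$ from $r$ (for $d\ge2$ and $n\ge 1$, these are the leaves). Put $w_c=\max\{0,1-\tfrac{q}{d+1}\}$ and, for $\alpha\in(0,1)$, $w(\alpha)=1-\tfrac{\alpha q}{d+1}$. There exist constants $C>0$ and $d_0>0$, depending only on $q$, such that for all integers $d\ge d_0$, all $\alpha\in(0,1)$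 and all $i\in\{1,\dots,q\}$ the following two statements hold: $$\lim_{n\to\infty}\ \max_{\tau:\Lambda_n\to\{1,\dots,q\}}\left|\mathrm{Pr}_{\mathbb T^n_{d+1};q,w_c}\big[\mathbf\Phi(r)=i\ \big|\ \mathbf\Phi\!\restriction_{\Lambda_n}=\tau\big]-\frac1q\right|=0,$$ and, for every integer $n\ge 0$ and every $\tau:\Lambda_n\to\{1,\dots,q\}$, $$\left|\mathrm{Pr}_{\mathbb T^n_{d+1};q,w(\alpha)}\big[\mathbf\Phi(r)=i\ \big|\ \mathbf\Phi\!\restriction_{\Lambda_n}=\tau\big]-\frac1q\right|\le C\,\alpha^{n/2}.$$ -/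

import Mathlib

open Filter Topology

namespace Potts

/-! ### The Potts model on a finite graph -/

section FiniteGraph

variable {V : Type*}

/-- The number `m(φ)` of edges `{u, v}` of `G` with `φ u = φ v`. -/
noncomputable def monoEdges (G : SimpleGraph V) {q : ℕ} (φ : V → Fin q) : ℕ :=
  {e : Sym2 V | e ∈ G.edgeSet ∧ (e.map φ).IsDiag}.ncard

/-- The partition function `Z(G; q, w) = ∑ w ^ m(σ)`, over all `σ : V → [q]`. -/
noncomputable def partitionFunction [Fintype V] (G : SimpleGraph V) (q : ℕ) (w : ℝ) : ℝ :=
  letI := Classical.decEq V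
  ∑ σ : V → Fin q, w ^ monoEdges G σ

/-- The Gibbs probability of a single configuration, `w ^ m(φ) / Z(G; q, w)`. -/
noncomputable def gibbs [Fintype V] (G : SimpleGraph V) (q : ℕ) (w : ℝ) (φ : V → Fin q) : ℝ :=
  w ^ monoEdges G φ / partitionFunction G q w

open Classical in
/-- The Gibbs probability of an event, that is, of a set of configurations. -/
noncomputable def prob [Fintype V] (G : SimpleGraph V) (q : ℕ) (w : ℝ)
    (A : Set (V → Fin q)) : ℝ :=
  ∑ φ : V → Fin q with φ ∈ A, gibbs G q w φ

/-- The conditional Gibbs probability of the event `A` given the event `B`. -/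
noncomputable def condProb [Fintype V] (G : SimpleGraph V) (q : ℕ) (w : ℝ)
    (A B : Set (V → Fin q)) : ℝ :=
  prob G q w (A ∩ B) / prob G q w B

end FiniteGraph

/-! ### The truncated regular tree -/

/-- The vertices of the rooted tree in which the root and all other vertices at distance less than
`n` from the root have exactly `d` children, cut off at distance `n` from the root. A vertex is
given by its address: the list of at most `n` choices of a child on the way from the root to it. -/
abbrev TreeVertex (d n : ℕ) : Type := {l : List (Fin d) // l.length ≤ n}

noncomputable instance (d n : ℕ) : Fintype (TreeVertex d n) :=
  (List.finite_length_le (Fin d) n).fintype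

/-- The tree obtained from the infinite `(d + 1)`-regular tree with root `r` by deleting one
neighbour of `r`, deleting all vertices at distance more than `n` from `r`, and keeping the
component of `r`. Two vertices are adjacent if one of them is a child of the other. -/
def tree (d n : ℕ) : SimpleGraph (TreeVertex d n) where
  Adj u v := (∃ a : Fin d, v.1 = u.1 ++ [a]) ∨ (∃ a : Fin d, u.1 = v.1 ++ [a])
  symm := ⟨fun _ _ h => h.symm⟩
  loopless := ⟨fun u h => by simp at h⟩

/-- The root `r` of the tree. -/
def root (d n : ℕ) : TreeVertex d n := ⟨[], Nat.zero_le n⟩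

/-- The set `Λ_n` of vertices at distance `n` from the root. For `n = 0` it is `{r}`; for `n ≥ 1` and
`d ≥ 2` it is the set of leaves, see `mem_boundary_iff_leaf`. -/
def boundary (d n : ℕ) : Set (TreeVertex d n) := {v | v.1.length = n}

theorem mem_boundary_iff_leaf {d n : ℕ} (hd : 2 ≤ d) (hn : 1 ≤ n) (v : TreeVertex d n) :
    v ∈ boundary d n ↔ ∃! u, (tree d n).Adj v u := by
  obtain ⟨l, hl⟩ := v
  constructor
  · intro h
    have h : l.length = n := h
    have hne : l ≠ [] := by rintro rfl; simp at h; omega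
    refine ⟨⟨l.dropLast, by simp; omega⟩, Or.inr ⟨l.getLast hne, ?_⟩, ?_⟩
    · exact (List.dropLast_append_getLast hne).symm
    · rintro ⟨u, hu⟩ (⟨a, ha⟩ | ⟨a, ha⟩)
      · simp only at ha
        subst ha
        simp at hu
        omega
      · simp only at ha
        subst ha
        simp
  · rintro ⟨u, -, hu⟩
    by_contra h
    have hlt : l.length < n := lt_of_le_of_ne hl h
    have key : ∀ a : Fin d, (⟨l ++ [a], by simp; omega⟩ : TreeVertex d n) = u :=
      fun a => hu _ (Or.inl ⟨a, rfl⟩)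
    have h01 := (key ⟨0, by omega⟩).trans (key ⟨1, by omega⟩).symm
    simp at h01

/-- The conditional probability that the root of the tree of depth `n` has color `i`, given that the
restriction of the random coloring to `Λ_n` is `τ`. -/
noncomputable def rootProb (d n q : ℕ) (w : ℝ) (τ : boundary d n → Fin q) (i : Fin q) : ℝ :=
  condProb (tree d n) q w {φ | φ (root d n) = i} {φ | ∀ v : boundary d n, φ v = τ v}

/-- The threshold `w_c = max {0, 1 - q / Δ}` of the `Δ`-regular tree. -/
noncomputable def criticalWeight (q Δ : ℕ) : ℝ := max 0 (1 - (q : ℝ) / (Δ : ℝ))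

end Potts

/-!
The messages sent up the tree are the conditional color distributions of the roots of the subtrees.
Written as `x = q p`, a message with children messages `x_a` is, by `mul_rootProb_succ`,
proportional to the exponential of `β` times the mean over `a` of `critLog D (x_a - 1)`, where
`D = (d + 1 - α) / α ≥ d` and `β = d / D ≤ α`. So the model with parameter `α` is the critical model
of a (real) degree `D`, damped by the factor `β`, and both claims follow once the critical recursion
is understood for all large real `D`.

In logarithmic coordinates the linear part of the critical map at the uniform message is `-1`, and
its quadratic part makes the map expand in some directions. The quadratic parts cancel over two
steps, which leaves a cubic drift to the fixed point. The averaging over children between the two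
steps is handled by convexity. The sets at one parity are the simplices `IsBalanced c` of messages
whose centered logarithms are at most `c`; at the other parity they are the sublevel sets of
`𝔼 k, gauge c D (z k - z i)`, one for each color `i`. As `gauge` is convex and vanishes at `0`,
averaging and damping preserve the latter.

For `D = ∞` the averaged gauge is the reciprocal of a message minus `1`, and
`expect_exp_softRatio_sub_le` shows that from the simplex of size `c` this reciprocal is at most
`exp (exp c - 1)`: one averages the inequality `exp (1 - x) ≤ 1 - (x - 1) + X (x - 1 - log x)`,
valid for `0 < x ≤ X` and `1 ≤ X`. Hence the size after two steps is at most
`1 - exp (1 - exp c) ≤ c - c ^ 3 / 18`. For finite `D` the correction terms of order `1 / D` in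
`gauge` are chosen such that all quadratic discrepancies cancel, and what remains is `O(c ^ 3 / D)`
in both steps (`exists_expect_gauge_le`, `exists_critLog_sub_expect_le`), which for large `D` is
absorbed by the drift. The result is `exists_isBalanced_treeStep_treeStep`: two steps take the
simplex of size `c` to that of size `β (c - c ^ 3 / 36)`. For `α < 1` this is at most `α c`; at the
critical weight, where `β = 1`, iteration still converges to `0`.
-/

open scoped BigOperators

namespace Potts

/-! ### Elementary estimates -/

theorem abs_exp_sub_one_le {t r : ℝ} (h : |t| ≤ r) : |Real.exp t - 1| ≤ Real.exp r * |t| := by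
  have h1 := Complex.norm_exp_sub_sum_le_norm_mul_exp (t : ℂ) 1
  have h2 : Complex.exp (t : ℂ) - ∑ m ∈ Finset.range 1, (t : ℂ) ^ m / (m.factorial : ℂ)
      = ((Real.exp t - 1 : ℝ) : ℂ) := by simp
  rw [h2, Complex.norm_real, Complex.norm_real, Real.norm_eq_abs, Real.norm_eq_abs, pow_one] at h1
  calc _ ≤ _ := h1
    _ ≤ |t| * Real.exp r := by gcongr
    _ = _ := mul_comm _ _

theorem abs_exp_sub_one_sub_le {t r : ℝ} (h : |t| ≤ r) :
    |Real.exp t - 1 - t| ≤ Real.exp r * t ^ 2 := by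
  have h1 := Complex.norm_exp_sub_sum_le_norm_mul_exp (t : ℂ) 2
  have h2 : Complex.exp (t : ℂ) - ∑ m ∈ Finset.range 2, (t : ℂ) ^ m / (m.factorial : ℂ)
      = ((Real.exp t - 1 - t : ℝ) : ℂ) := by simp [Finset.sum_range_succ]; ring
  rw [h2, Complex.norm_real, Complex.norm_real, Real.norm_eq_abs, Real.norm_eq_abs, sq_abs] at h1
  calc _ ≤ _ := h1
    _ ≤ t ^ 2 * Real.exp r := by gcongr
    _ = _ := mul_comm _ _

/-- The logarithm of the message factor of one child, rescaled so that its derivative at the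
uniform message `a = 0` is `-1`. Here `1 + a` is `q` times the probability of a color at the child;
the critical weight of the `(d + 1)`-regular tree corresponds to `D = d`, and smaller interactions
to larger, not necessarily integral, values of `D`. -/
noncomputable def critLog (D a : ℝ) : ℝ := D * Real.log (1 - a / D)

theorem abs_critLog_add_le {D a : ℝ} (hD : 1 ≤ D) (ha : 2 * |a| ≤ D) :
    |critLog D a + a + a ^ 2 / (2 * D)| ≤ 2 * |a| ^ 3 / D := by
  have hD0 : 0 < D := by linarith
  have habs : |a / D| = |a| / D := by rw [abs_div, abs_of_pos hD0]
  have h2 : |a / D| ≤ 1 / 2 := by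
    rw [habs, div_le_div_iff₀ hD0 (by norm_num)]; linarith
  have h1 := Real.abs_log_sub_add_sum_range_le (x := a / D) (by linarith) 2
  have e : critLog D a + a + a ^ 2 / (2 * D)
      = D * ((∑ i ∈ Finset.range 2, (a / D) ^ (i + 1) / (i + 1 : ℝ)) + Real.log (1 - a / D)) := by
    simp [Finset.sum_range_succ, critLog]; field_simp; ring
  rw [e, abs_mul, abs_of_pos hD0]
  have h3 : |a / D| ^ (2 + 1) / (1 - |a / D|) ≤ 2 * |a / D| ^ 3 := by
    rw [div_le_iff₀ (by linarith)]
    nlinarith [pow_nonneg (abs_nonneg (a / D)) 3]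
  calc D * _ ≤ D * (2 * |a / D| ^ 3) := by
        gcongr; exact h1.trans h3
    _ = 2 * |a| ^ 3 / D / D := by rw [habs]; field_simp
    _ ≤ _ := div_le_self (by positivity) hD

theorem abs_critLog_le {D a : ℝ} (hD : 1 ≤ D) (ha : 2 * |a| ≤ D) :
    |critLog D a| ≤ 2 * |a| := by
  have hD0 : 0 < D := by linarith
  have habs : |a / D| = |a| / D := by rw [abs_div, abs_of_pos hD0]
  have h2 : |a / D| ≤ 1 / 2 := by
    rw [habs, div_le_div_iff₀ hD0 (by norm_num)]; linarith
  have h1 := Real.abs_log_sub_add_sum_range_le (x := a / D) (by linarith) 0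
  simp only [Finset.range_zero, Finset.sum_empty, zero_add, pow_one] at h1
  have h3 : |a / D| / (1 - |a / D|) ≤ 2 * |a / D| := by
    rw [div_le_iff₀ (by linarith)]
    nlinarith [abs_nonneg (a / D)]
  rw [critLog, abs_mul, abs_of_pos hD0]
  calc D * _ ≤ D * (2 * |a / D|) := by gcongr; exact h1.trans h3
    _ = _ := by rw [habs]; field_simp

/-- The convex gauge that controls the messages at odd distance from the boundary. The quadratic
correction of order `1 / D` is what makes two steps of the recursion agree with the identity up to
third order, uniformly in `D`. -/
noncomputable def gauge (c D w : ℝ) : ℝ :=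
  (1 - 2 * c / D) * (Real.exp w - 1) + (Real.exp w - 1) ^ 2 / (2 * D)

theorem convexOn_gauge {c D : ℝ} (hD : 0 < D) (h : 2 * c + 1 ≤ D) :
    ConvexOn ℝ Set.univ (gauge c D) := by
  have h1 : ConvexOn ℝ Set.univ (fun w : ℝ => Real.exp w) := convexOn_exp
  have h2 : ConvexOn ℝ Set.univ (fun w : ℝ => Real.exp (2 * w)) := by
    exact convexOn_exp.comp_linearMap (LinearMap.mulLeft ℝ (2 : ℝ))
  have e : gauge c D = fun w => (((1 - (2 * c + 1) / D) • (fun w : ℝ => Real.exp w)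
      + (1 / (2 * D)) • (fun w : ℝ => Real.exp (2 * w))) w + (-(1 - 2 * c / D) + 1 / (2 * D))) := by
    funext w
    have : Real.exp (2 * w) = Real.exp w ^ 2 := by rw [← Real.exp_nat_mul]; norm_num
    simp only [gauge, Pi.add_apply, Pi.smul_apply, smul_eq_mul, this]
    field_simp; ring
  rw [e]
  refine ((h1.smul ?_).add (h2.smul (by positivity))).add_const _
  rw [sub_nonneg, div_le_one hD]; exact h

/-- Second-order expansion of the gauge at the difference of two log-messages at distance `O(c)` from
the uniform one. Averaged over values of `b` with mean `0`, the terms of order `1 / D` become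
`((a - c) ^ 2 - c ^ 2) / D`. -/
theorem gauge_critLog_sub_le {B : ℝ} (hB : 0 ≤ B) : ∃ K, 0 ≤ K ∧ ∀ c D a b : ℝ,
    0 ≤ c → c ≤ 2 → 1 ≤ D → 4 * B ≤ D → |a| ≤ B * c → |b| ≤ B * c →
      gauge c D (critLog D b - critLog D a) ≤ (Real.exp (a - b) - 1)
        + (a ^ 2 - b ^ 2 + (a - b) ^ 2 - 4 * c * (a - b)) / (2 * D) + K * c ^ 3 / D := by
  obtain ⟨K1, hK1⟩ : ∃ K1, K1 = B ^ 2 + 8 * B ^ 3 := ⟨_, rfl⟩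
  have hK10 : 0 ≤ K1 := by rw [hK1]; positivity
  obtain ⟨E1, hE1⟩ : ∃ E1, E1 = Real.exp (4 * K1) := ⟨_, rfl⟩
  obtain ⟨E2, hE2⟩ : ∃ E2, E2 = Real.exp (4 * B) := ⟨_, rfl⟩
  obtain ⟨E3, hE3⟩ : ∃ E3, E3 = Real.exp (4 * B + 4 * K1) := ⟨_, rfl⟩
  have hE10 : 0 < E1 := by rw [hE1]; positivity
  have hE20 : 0 < E2 := by rw [hE2]; positivity
  have hE30 : 0 < E3 := by rw [hE3]; positivity
  -- bound for `exp w - exp (a - b) - (a ^ 2 - b ^ 2) / (2 * D)`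
  obtain ⟨K2, hK2⟩ : ∃ K2, K2 = 2 * E1 * E2 * K1 ^ 2 + 2 * E2 * B * K1 + 4 * B ^ 3 := ⟨_, rfl⟩
  -- bound for `exp w - 1 - (a - b)`
  obtain ⟨K3, hK3⟩ : ∃ K3, K3 = E3 * (2 * B + 2 * K1) ^ 2 + K1 := ⟨_, rfl⟩
  have hK30 : 0 ≤ K3 := by rw [hK3]; positivity
  refine ⟨K2 + 2 * K3 + K3 * (2 * K3 + 4 * B) / 2, by rw [hK2]; positivity, ?_⟩
  intro c D a b hc hc2 hD hBD ha hb
  have hD0 : 0 < D := by linarith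
  obtain ⟨e, he⟩ : ∃ e, e = 1 / D := ⟨_, rfl⟩
  have he0 : 0 < e := by rw [he]; positivity
  have he1 : e ≤ 1 := by rw [he, div_le_one hD0]; exact hD
  have hBc : B * c ≤ B * 2 := by gcongr
  obtain ⟨w, hw⟩ : ∃ w, w = critLog D b - critLog D a := ⟨_, rfl⟩
  obtain ⟨n, hn⟩ : ∃ n, n = w - (a - b) := ⟨_, rfl⟩
  have ha3 : 2 * |a| ^ 3 / D ≤ 2 * (B * c) ^ 3 * e := by
    rw [he, mul_one_div]; gcongr
  have hb3 : 2 * |b| ^ 3 / D ≤ 2 * (B * c) ^ 3 * e := by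
    rw [he, mul_one_div]; gcongr
  have hza := (abs_critLog_add_le (a := a) hD (by linarith)).trans ha3
  have hzb := (abs_critLog_add_le (a := b) hD (by linarith)).trans hb3
  have hsa : a ^ 2 ≤ B ^ 2 * c ^ 2 := by
    rw [← mul_pow, ← sq_abs]; gcongr
  have hsb : b ^ 2 ≤ B ^ 2 * c ^ 2 := by
    rw [← mul_pow, ← sq_abs]; gcongr
  have hdiv : ∀ x : ℝ, x / (2 * D) = x * e / 2 := by intro x; rw [he]; field_simp
  rw [hdiv, abs_le] at hza hzb
  have hr : |n - (a ^ 2 - b ^ 2) * e / 2| ≤ 4 * B ^ 3 * c ^ 3 * e := by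
    rw [abs_le, hn, hw]
    constructor
    · linarith only [hza.2, hzb.1]
    · linarith only [hza.1, hzb.2]
  have hc3 : c ^ 3 * e ≤ 2 * (c ^ 2 * e) := by
    have : 0 ≤ (2 - c) * (c ^ 2 * e) := by
      apply mul_nonneg (by linarith); positivity
    linarith only [this]
  have hsd : |(a ^ 2 - b ^ 2) * e / 2| ≤ B ^ 2 * c ^ 2 * e := by
    have h1 : (a ^ 2 - b ^ 2) * e ≤ (B ^ 2 * c ^ 2) * e := by gcongr; linarith only [sq_nonneg b, hsa]
    have h2 : (-(B ^ 2 * c ^ 2)) * e ≤ (a ^ 2 - b ^ 2) * e := by gcongr; linarith only [sq_nonneg a, hsb]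
    have : 0 ≤ B ^ 2 * c ^ 2 * e := by positivity
    rw [abs_le]; constructor <;> linarith only [h1, h2, this]
  have hnK : |n| ≤ K1 * (c ^ 2 * e) := by
    have h1 : |n| ≤ |n - (a ^ 2 - b ^ 2) * e / 2| + |(a ^ 2 - b ^ 2) * e / 2| := by
      have := abs_add_le (n - (a ^ 2 - b ^ 2) * e / 2) ((a ^ 2 - b ^ 2) * e / 2)
      rwa [sub_add_cancel] at this
    have h2 : 4 * B ^ 3 * (c ^ 3 * e) ≤ 4 * B ^ 3 * (2 * (c ^ 2 * e)) := by gcongr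
    rw [hK1]; linarith only [h1, h2, hr, hsd]
  have hce : c ^ 2 * e ≤ c ^ 2 := mul_le_of_le_one_right (by positivity) he1
  have hnc : |n| ≤ K1 * c ^ 2 := hnK.trans (by gcongr)
  have hc4 : c ^ 2 ≤ 2 * c := by rw [sq]; gcongr
  have hn4 : |n| ≤ 4 * K1 := by
    have : K1 * c ^ 2 ≤ K1 * 4 := by gcongr; linarith only [hc4, hc2]
    linarith only [this, hnc]
  have hm : |a - b| ≤ 2 * B * c := by
    have := abs_sub a b
    linarith only [this, ha, hb]
  have hm4 : |a - b| ≤ 4 * B := by linarith only [hm, hBc]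
  have hwmn : w = (a - b) + n := by rw [hn]; ring
  have hwabs : |w| ≤ (2 * B + 2 * K1) * c := by
    have h1 := abs_add_le (a - b) n
    have h2 : K1 * c ^ 2 ≤ K1 * (2 * c) := by gcongr
    rw [hwmn]; linarith only [h1, h2, hm, hnc]
  have hw4 : |w| ≤ 4 * B + 4 * K1 := by
    have h1 := abs_add_le (a - b) n
    rw [hwmn]; linarith only [h1, hm4, hn4]
  -- first estimate
  have hen := abs_exp_sub_one_sub_le hn4
  have hem := abs_exp_sub_one_le hm4
  rw [← hE1] at hen
  rw [← hE2] at hem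
  have hemE : Real.exp (a - b) ≤ E2 := by rw [hE2]; exact Real.exp_le_exp.2 (le_of_abs_le hm4)
  have hn2 : n ^ 2 ≤ 2 * K1 ^ 2 * (c ^ 3 * e) := by
    rw [← sq_abs]
    calc |n| ^ 2 ≤ (K1 * (c ^ 2 * e)) * (K1 * c ^ 2) := by rw [sq]; gcongr
      _ = K1 ^ 2 * (c ^ 3 * e) * c := by ring
      _ ≤ K1 ^ 2 * (c ^ 3 * e) * 2 := by gcongr
      _ = _ := by ring
  have hF1 : |Real.exp w - Real.exp (a - b) - (a ^ 2 - b ^ 2) * e / 2| ≤ K2 * (c ^ 3 * e) := by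
    have h1 : |Real.exp (a - b) * (Real.exp n - 1 - n)| ≤ E2 * (E1 * (2 * K1 ^ 2 * (c ^ 3 * e))) := by
      rw [abs_mul, abs_of_pos (Real.exp_pos _)]
      gcongr
      exact hen.trans (by gcongr)
    have h2 : |(Real.exp (a - b) - 1) * n| ≤ (E2 * (2 * B * c)) * (K1 * (c ^ 2 * e)) := by
      rw [abs_mul]
      gcongr
      exact hem.trans (by gcongr)
    have h3 : Real.exp w - Real.exp (a - b) - (a ^ 2 - b ^ 2) * e / 2
        = Real.exp (a - b) * (Real.exp n - 1 - n) + (Real.exp (a - b) - 1) * n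
          + (n - (a ^ 2 - b ^ 2) * e / 2) := by
      rw [hwmn, Real.exp_add]; ring
    rw [h3]
    refine (abs_add_le _ _).trans ?_
    refine (add_le_add ((abs_add_le _ _).trans (add_le_add h1 h2)) hr).trans (le_of_eq ?_)
    rw [hK2]; ring
  have hF2 : |Real.exp w - 1 - (a - b)| ≤ K3 * c ^ 2 := by
    have h1 := abs_exp_sub_one_sub_le hw4
    rw [← hE3] at h1
    have h2 : E3 * w ^ 2 ≤ E3 * ((2 * B + 2 * K1) * c) ^ 2 := by
      rw [← sq_abs w]; gcongr
    have h3 : Real.exp w - 1 - (a - b) = (Real.exp w - 1 - w) + n := by rw [hwmn]; ring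
    rw [h3]
    refine (abs_add_le _ _).trans ((add_le_add (h1.trans h2) hnc).trans (le_of_eq ?_))
    rw [hK3]; ring
  have hF3 : (Real.exp w - 1) ^ 2 ≤ (a - b) ^ 2 + K3 * (2 * K3 + 4 * B) * c ^ 3 := by
    have h1 : (Real.exp w - 1) ^ 2 - (a - b) ^ 2
        = (Real.exp w - 1 - (a - b)) * ((Real.exp w - 1 - (a - b)) + 2 * (a - b)) := by ring
    have h2 : |(Real.exp w - 1 - (a - b)) + 2 * (a - b)| ≤ (2 * K3 + 4 * B) * c := by
      refine (abs_add_le _ _).trans ?_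
      rw [abs_mul, abs_two]
      have : K3 * c ^ 2 ≤ K3 * (2 * c) := by gcongr
      linarith only [this, hF2, hm]
    have h3 := mul_le_mul hF2 h2 (abs_nonneg _) (by positivity)
    rw [← abs_mul, ← h1] at h3
    have := le_of_abs_le h3
    linarith only [this]
  have hF4 : (Real.exp w - 1) ^ 2 * e ≤ ((a - b) ^ 2 + K3 * (2 * K3 + 4 * B) * c ^ 3) * e := by
    gcongr
  have hF5 : (-(2 * c * e)) * (Real.exp w - 1 - (a - b)) ≤ 2 * K3 * (c ^ 3 * e) := by
    have h1 := neg_le_of_abs_le hF2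
    have h2 : (2 * c * e) * (-(Real.exp w - 1 - (a - b))) ≤ (2 * c * e) * (K3 * c ^ 2) := by
      gcongr; linarith only [h1]
    linarith only [h2]
  have hF1' := le_of_abs_le hF1
  rw [← hw, gauge, hdiv, hdiv, show 2 * c / D = 2 * c * e by rw [he]; ring,
    show ∀ x, x / D = x * e by intro x; rw [he]; ring]
  linarith only [hF1', hF4, hF5]

/-! ### Normalized messages -/

section SoftRatio

variable {ι : Type*} [Fintype ι] [Nonempty ι]

/-- The probability vector proportional to `exp (y i)`, multiplied by the number of colors, so that
its mean is `1` and the uniform distribution is the constant vector `1`. -/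
noncomputable def softRatio (y : ι → ℝ) (i : ι) : ℝ := Real.exp (y i) / 𝔼 k, Real.exp (y k)

theorem expect_exp_pos (y : ι → ℝ) : 0 < 𝔼 k, Real.exp (y k) :=
  Finset.expect_pos (fun _ _ => Real.exp_pos _) Finset.univ_nonempty

theorem softRatio_pos (y : ι → ℝ) (i : ι) : 0 < softRatio y i :=
  div_pos (Real.exp_pos _) (expect_exp_pos y)

theorem expect_softRatio (y : ι → ℝ) : 𝔼 i, softRatio y i = 1 := by
  unfold softRatio
  rw [← Finset.expect_div, div_self (expect_exp_pos y).ne']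

theorem softRatio_add_const {ι : Type*} [Fintype ι] (y : ι → ℝ) (t : ℝ) : softRatio (fun k => y k + t) = softRatio y := by
  funext i
  simp only [softRatio, Real.exp_add]
  rw [← Finset.expect_mul, mul_div_mul_right _ _ (Real.exp_ne_zero t)]

theorem softRatio_sub_const {ι : Type*} [Fintype ι] (y : ι → ℝ) (t : ℝ) : softRatio (fun k => y k - t) = softRatio y := by
  simpa [sub_eq_add_neg] using softRatio_add_const y (-t)

theorem abs_expect_le {f : ι → ℝ} {t : ℝ} (h : ∀ k, |f k| ≤ t) : |𝔼 k, f k| ≤ t := by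
  refine (Finset.abs_expect_le _ _).trans ?_
  exact Finset.expect_le Finset.univ_nonempty (fun k _ => h k)

theorem abs_le_of_expect_eq_zero {y : ι → ℝ} {c : ℝ} (h0 : 𝔼 k, y k = 0) (hc : ∀ k, y k ≤ c)
    (k : ι) : |y k| ≤ Fintype.card ι * c := by
  have hs : ∑ k, y k = 0 := by
    rw [← Fintype.card_mul_expect, h0, mul_zero]
  have h1 : c - y k ≤ ∑ j, (c - y j) :=
    Finset.single_le_sum (f := fun j => c - y j) (fun j _ => sub_nonneg.2 (hc j))
      (Finset.mem_univ k)
  rw [Finset.sum_sub_distrib, hs, Finset.sum_const, Finset.card_univ, nsmul_eq_mul, sub_zero] at h1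
  have hc0 : 0 ≤ c := by
    have : 𝔼 k, y k ≤ c := Finset.expect_le Finset.univ_nonempty (fun k _ => hc k)
    linarith
  have hcard : (1 : ℝ) ≤ Fintype.card ι := by exact_mod_cast Fintype.card_pos (α := ι)
  have : c ≤ Fintype.card ι * c := le_mul_of_one_le_left hc0 hcard
  rw [abs_le]; constructor <;> linarith [hc k]

theorem one_le_expect_exp {y : ι → ℝ} (h0 : 𝔼 k, y k = 0) : 1 ≤ 𝔼 k, Real.exp (y k) := by
  have : 𝔼 k, (y k + 1) ≤ 𝔼 k, Real.exp (y k) :=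
    Finset.expect_le_expect fun k _ => Real.add_one_le_exp _
  rwa [Finset.expect_add_distrib, h0, Fintype.expect_const, zero_add] at this

theorem expect_exp_sub_one_le {y : ι → ℝ} {r R : ℝ} (h0 : 𝔼 k, y k = 0) (hR : r ≤ R)
    (hy : ∀ k, |y k| ≤ r) : (𝔼 k, Real.exp (y k)) - 1 ≤ Real.exp R * r ^ 2 := by
  have h1 : 𝔼 k, (Real.exp (y k) - 1 - y k) ≤ Real.exp R * r ^ 2 := by
    refine Finset.expect_le Finset.univ_nonempty fun k _ => ?_
    refine (le_of_abs_le (abs_exp_sub_one_sub_le ((hy k).trans hR))).trans ?_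
    rw [← sq_abs]
    gcongr
    exact hy k
  rw [Finset.expect_sub_distrib, Finset.expect_sub_distrib, h0, Fintype.expect_const] at h1
  linarith

theorem abs_softRatio_sub_one_le {y : ι → ℝ} {r R : ℝ} (h0 : 𝔼 k, y k = 0) (hR : r ≤ R)
    (hy : ∀ k, |y k| ≤ r) (i : ι) :
    |softRatio y i - 1| ≤ Real.exp R * (1 + R) * r := by
  have hr : 0 ≤ r := (abs_nonneg _).trans (hy i)
  have hM := one_le_expect_exp h0
  have hM2 := expect_exp_sub_one_le h0 hR hy
  have h1 := (abs_exp_sub_one_le ((hy i).trans hR))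
  have e : softRatio y i - 1 = (Real.exp (y i) - 𝔼 k, Real.exp (y k)) / 𝔼 k, Real.exp (y k) := by
    rw [softRatio, sub_div, div_self (expect_exp_pos y).ne']
  rw [e, abs_div, abs_of_pos (expect_exp_pos y)]
  refine (div_le_self (abs_nonneg _) hM).trans ?_
  have h2 : |Real.exp (y i) - 𝔼 k, Real.exp (y k)|
      ≤ |Real.exp (y i) - 1| + ((𝔼 k, Real.exp (y k)) - 1) := by
    have := abs_sub_le (Real.exp (y i)) 1 (𝔼 k, Real.exp (y k))
    rwa [abs_sub_comm 1, abs_of_nonneg (sub_nonneg.2 hM)] at this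
  have h3 : Real.exp R * |y i| ≤ Real.exp R * r := by gcongr; exact hy i
  have h4 : Real.exp R * r ^ 2 ≤ Real.exp R * (r * R) := by rw [sq]; gcongr
  linarith

/-! ### The limiting two-step inequality -/

/-- Both sides agree to first order at `x = 1`. The term `X (x - 1 - log x)` is what lets the
constraint on the geometric mean enter when this is averaged over the colors. -/
theorem exp_one_sub_le {x X : ℝ} (hx : 0 < x) (hxX : x ≤ X) (hX : 1 ≤ X) :
    Real.exp (1 - x) ≤ 1 - (x - 1) + X * (x - 1 - Real.log x) := by
  have hlog := Real.log_le_sub_one_of_pos hx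
  rcases le_total x 1 with h | h
  · -- replace `X` by `1`
    have hmono : MonotoneOn (fun x : ℝ => Real.exp (1 - x) + Real.log x) (Set.Ioi 0) := by
      have hd : ∀ x : ℝ, 0 < x → HasDerivAt (fun x : ℝ => Real.exp (1 - x) + Real.log x)
          (Real.exp (1 - x) * (-1) + x⁻¹) x := fun x hx =>
        (((hasDerivAt_id x).const_sub 1).exp).add (Real.hasDerivAt_log hx.ne')
      refine monotoneOn_of_deriv_nonneg (convex_Ioi 0)
        (fun x hx => (hd x hx).continuousAt.continuousWithinAt)
        (fun x hx => ?_) fun x hx => ?_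
      · rw [interior_Ioi] at hx
        exact (hd x hx).differentiableAt.differentiableWithinAt
      · rw [interior_Ioi] at hx
        rw [(hd x hx).deriv]
        have h1 : Real.exp (1 - x) ≤ x⁻¹ := by
          rw [← Real.exp_log hx, ← Real.exp_neg, Real.exp_log hx]
          apply Real.exp_le_exp.2
          linarith [Real.log_le_sub_one_of_pos hx]
        linarith
    have h1 := hmono (Set.mem_Ioi.2 hx) (Set.mem_Ioi.2 one_pos) h
    simp only [sub_self, Real.exp_zero, Real.log_one, add_zero] at h1
    nlinarith
  · -- replace `X` by `x`
    have hmono : MonotoneOn (fun x : ℝ => 1 - (x - 1) + x * (x - 1 - Real.log x)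
        - Real.exp (1 - x)) (Set.Ici 1) := by
      have hd : ∀ x : ℝ, 0 < x → HasDerivAt (fun x : ℝ => 1 - (x - 1) + x * (x - 1 - Real.log x)
          - Real.exp (1 - x)) (-1 + (1 * (x - 1 - Real.log x) + x * (1 - x⁻¹))
            - Real.exp (1 - x) * (-1)) x := fun x hx =>
        ((((hasDerivAt_id x).sub_const 1).const_sub 1).add ((hasDerivAt_id x).mul
          (((hasDerivAt_id x).sub_const 1).sub (Real.hasDerivAt_log hx.ne')))).sub
          (((hasDerivAt_id x).const_sub 1).exp)
      refine monotoneOn_of_deriv_nonneg (convex_Ici 1)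
        (fun x hx => (hd x (by linarith [Set.mem_Ici.1 hx])).continuousAt.continuousWithinAt)
        (fun x hx => ?_) fun x hx => ?_
      · rw [interior_Ici] at hx
        exact (hd x (by linarith [Set.mem_Ioi.1 hx])).differentiableAt.differentiableWithinAt
      · rw [interior_Ici] at hx
        have hx0 : 0 < x := by linarith [Set.mem_Ioi.1 hx]
        rw [(hd x hx0).deriv, mul_sub x 1, mul_inv_cancel₀ hx0.ne']
        linarith [Real.log_le_sub_one_of_pos hx0, Real.add_one_le_exp (1 - x)]
    have h1 := hmono (Set.mem_Ici.2 le_rfl) (Set.mem_Ici.2 h) h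
    simp only [sub_self, Real.exp_zero, Real.log_one] at h1
    nlinarith

/-- In the limit `D → ∞`, the reciprocal of a message after two steps is at most
`exp (exp c - 1)`; the factor `exp (x i - X)` records the gain when color `i` is not extremal. -/
theorem expect_exp_softRatio_sub_le {y : ι → ℝ} {c : ℝ} (h0 : 𝔼 k, y k = 0) (hc : ∀ k, y k ≤ c)
    (i : ι) : 𝔼 k, Real.exp (softRatio y i - softRatio y k)
      ≤ Real.exp (softRatio y i - Real.exp c / 𝔼 k, Real.exp (y k))
        * Real.exp (Real.exp c - 1) := by
  obtain ⟨M, hM⟩ : ∃ M, M = 𝔼 k, Real.exp (y k) := ⟨_, rfl⟩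
  obtain ⟨X, hX⟩ : ∃ X, X = Real.exp c / M := ⟨_, rfl⟩
  have hM0 : 0 < M := hM ▸ expect_exp_pos y
  have hM1 : 1 ≤ M := hM ▸ one_le_expect_exp h0
  have hxX : ∀ k, softRatio y k ≤ X := by
    intro k
    rw [softRatio, ← hM, hX]
    gcongr
    exact hc k
  have hX1 : 1 ≤ X := by
    rw [← expect_softRatio y]
    exact Finset.expect_le Finset.univ_nonempty fun k _ => hxX k
  have hlog : ∀ k, Real.log (softRatio y k) = y k - Real.log M := by
    intro k
    rw [softRatio, ← hM, Real.log_div (Real.exp_ne_zero _) hM0.ne', Real.log_exp]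
  have h1 : 𝔼 k, Real.exp (1 - softRatio y k) ≤ 1 + X * Real.log M := by
    have := Finset.expect_le_expect (s := Finset.univ) fun k _ =>
      exp_one_sub_le (softRatio_pos y k) (hxX k) hX1
    refine this.trans (le_of_eq ?_)
    simp only [hlog]
    rw [Finset.expect_add_distrib, ← Finset.mul_expect, Finset.expect_sub_distrib,
      Finset.expect_sub_distrib, Finset.expect_sub_distrib, Finset.expect_sub_distrib,
      Finset.expect_sub_distrib, expect_softRatio, h0]
    simp only [Fintype.expect_const]
    ring
  rw [← hM, ← hX]
  have e : ∀ k, Real.exp (softRatio y i - softRatio y k)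
      = Real.exp (softRatio y i - X) * Real.exp (X - 1) * Real.exp (1 - softRatio y k) := by
    intro k
    rw [← Real.exp_add, ← Real.exp_add]; congr 1; ring
  simp only [e]
  rw [← Finset.mul_expect, mul_assoc]
  gcongr
  calc Real.exp (X - 1) * 𝔼 k, Real.exp (1 - softRatio y k)
      ≤ Real.exp (X - 1) * Real.exp (X * Real.log M) := by
        gcongr
        have := Real.add_one_le_exp (X * Real.log M)
        linarith
    _ = Real.exp (X * (1 + Real.log M) - 1) := by rw [← Real.exp_add]; congr 1; ring
    _ ≤ Real.exp (Real.exp c - 1) := by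
        have : 1 + Real.log M ≤ M := by linarith [Real.log_le_sub_one_of_pos hM0]
        have h2 : X * (1 + Real.log M) ≤ X * M := by gcongr
        have h3 : X * M = Real.exp c := by rw [hX]; field_simp
        apply Real.exp_le_exp.2
        linarith

/-- The critical map has a cubic drift towards the fixed point. -/
theorem one_sub_exp_le {c : ℝ} (hc : 0 ≤ c) (hc2 : c ≤ 2) :
    1 - Real.exp (1 - Real.exp c) ≤ c - c ^ 3 / 18 := by
  have hd : ∀ x : ℝ, HasDerivAt (fun x : ℝ => Real.exp (1 - Real.exp x) - 1 + x - x ^ 3 / 18)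
      (Real.exp (1 - Real.exp x) * (-Real.exp x) + 1 - (3 : ℕ) * x ^ (3 - 1) / 18) x := fun x =>
    (((((Real.hasDerivAt_exp x).const_sub 1).exp).sub_const 1).add (hasDerivAt_id x)).sub
      ((hasDerivAt_pow 3 x).div_const 18)
  have hmono : MonotoneOn (fun x : ℝ => Real.exp (1 - Real.exp x) - 1 + x - x ^ 3 / 18)
      (Set.Icc 0 2) := by
    refine monotoneOn_of_deriv_nonneg (convex_Icc 0 2)
      (fun x _ => (hd x).continuousAt.continuousWithinAt)
      (fun x _ => (hd x).differentiableAt.differentiableWithinAt) fun x hx => ?_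
    rw [interior_Icc] at hx
    obtain ⟨hx0, hx2⟩ := hx
    rw [(hd x).deriv]
    have h1 : 1 + x + x ^ 2 / 2 ≤ Real.exp x := Real.quadratic_le_exp_of_nonneg hx0.le
    have h2 : Real.exp (1 - Real.exp x) * Real.exp x ≤ 1 / (1 + x ^ 2 / 2) := by
      rw [← Real.exp_add]
      calc Real.exp (1 - Real.exp x + x) ≤ Real.exp (-(x ^ 2 / 2)) :=
            Real.exp_le_exp.2 (by linarith)
        _ = 1 / Real.exp (x ^ 2 / 2) := by rw [Real.exp_neg, one_div]
        _ ≤ _ := by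
            gcongr
            linarith [Real.add_one_le_exp (x ^ 2 / 2)]
    have h3 : 1 / (1 + x ^ 2 / 2) ≤ 1 - x ^ 2 / 6 := by
      rw [div_le_iff₀ (by positivity)]
      have : x ^ 2 ≤ 4 := by nlinarith
      nlinarith [sq_nonneg x]
    norm_num
    linarith
  have h := hmono (Set.mem_Icc.2 ⟨le_rfl, by norm_num⟩) (Set.mem_Icc.2 ⟨hc, hc2⟩) hc
  simp only [Real.exp_zero, sub_self] at h
  norm_num at h
  linarith

end SoftRatio

section TwoStep

variable {ι : Type*} [Fintype ι] [Nonempty ι]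

/-! ### The first step -/

/-- The first step takes balanced messages into a sublevel set of the averaged gauge, whose level is
that of the limit `D = ∞` up to a cubic error. A color `i` that is not extremal contributes a term
`(x i - 1 - c) ^ 2 / D`, which the gap in `expect_exp_softRatio_sub_le` absorbs. -/
theorem exists_expect_gauge_le (ι : Type*) [Fintype ι] [Nonempty ι] :
    ∃ K D₀ : ℝ, 0 ≤ K ∧ 1 ≤ D₀ ∧ ∀ (c D : ℝ) (y : ι → ℝ) (i : ι),
      0 ≤ c → c ≤ 2 → D₀ ≤ D → 𝔼 k, y k = 0 → (∀ k, y k ≤ c) →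
      (𝔼 k, gauge c D (critLog D (softRatio y k - 1) - critLog D (softRatio y i - 1))) + c ^ 2 / D
        ≤ Real.exp (Real.exp c - 1) - 1 + K * c ^ 3 / D := by
  obtain ⟨Q, hQ⟩ : ∃ Q : ℝ, Q = Fintype.card ι := ⟨_, rfl⟩
  have hQ0 : 0 ≤ Q := by rw [hQ]; positivity
  obtain ⟨E, hE⟩ : ∃ E, E = Real.exp (Q * 2) := ⟨_, rfl⟩
  have hE0 : 0 < E := by rw [hE]; positivity
  obtain ⟨B, hB⟩ : ∃ B, B = E * (1 + Q * 2) * Q := ⟨_, rfl⟩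
  have hB0 : 0 ≤ B := by rw [hB]; positivity
  obtain ⟨K0, hK0, hgauge⟩ := gauge_critLog_sub_le hB0
  obtain ⟨Z, hZ⟩ : ∃ Z, Z = Real.exp 2 := ⟨_, rfl⟩
  have hZ0 : 0 < Z := by rw [hZ]; positivity
  obtain ⟨K1, hK1⟩ : ∃ K1, K1 = Z + 3 * (E * Q ^ 2) := ⟨_, rfl⟩
  have hK10 : 0 ≤ K1 := by rw [hK1]; positivity
  refine ⟨K0 + 4 * K1 ^ 2, 1 + 4 * B + 2 * Z * (1 + Z), by positivity, ?_, ?_⟩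
  · have : 0 ≤ 4 * B + 2 * Z * (1 + Z) := by positivity
    linarith
  intro c D y i hc hc2 hD h0 hyc
  have hZZ : 0 ≤ 2 * Z * (1 + Z) := by positivity
  have hD1 : 1 ≤ D := by linarith
  have hDB : 4 * B ≤ D := by linarith
  have hDZ : 2 * Z * (1 + Z) ≤ D := by linarith
  have hD0 : 0 < D := by linarith
  clear hD
  have hy : ∀ k, |y k| ≤ Q * c := fun k => hQ ▸ abs_le_of_expect_eq_zero h0 hyc k
  have hQc : Q * c ≤ Q * 2 := by gcongr
  have hδ : ∀ k, |softRatio y k - 1| ≤ B * c := by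
    intro k
    refine (abs_softRatio_sub_one_le h0 hQc hy k).trans (le_of_eq ?_)
    rw [hB, hE]; ring
  obtain ⟨M, hM⟩ : ∃ M, M = 𝔼 k, Real.exp (y k) := ⟨_, rfl⟩
  obtain ⟨X, hX⟩ : ∃ X, X = Real.exp c / M := ⟨_, rfl⟩
  obtain ⟨G, hG⟩ : ∃ G, G = Real.exp (Real.exp c - 1) := ⟨_, rfl⟩
  obtain ⟨x, hx⟩ : ∃ x, x = softRatio y i := ⟨_, rfl⟩
  have hM1 : 1 ≤ M := hM ▸ one_le_expect_exp h0
  have hM0 : 0 < M := by linarith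
  have hM2 : M - 1 ≤ E * (Q * c) ^ 2 := by
    rw [hM, hE]; exact expect_exp_sub_one_le h0 hQc hy
  have hexpc : Real.exp c ≤ Z := by rw [hZ]; exact Real.exp_le_exp.2 hc2
  have hXZ : X ≤ Z := by
    rw [hX]; exact (div_le_self (Real.exp_pos _).le hM1).trans hexpc
  have hxX : x ≤ X := by
    rw [hx, hX, softRatio, ← hM]; gcongr; exact hyc i
  have hx0 : 0 < x := hx ▸ softRatio_pos y i
  have hG1 : 1 ≤ G := by
    rw [hG]; apply Real.one_le_exp; linarith [Real.add_one_le_exp c]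
  have hH : 𝔼 k, Real.exp (softRatio y i - softRatio y k) ≤ Real.exp (x - X) * G := by
    rw [hx, hX, hG, hM]; exact expect_exp_softRatio_sub_le h0 hyc i
  -- sum of the pointwise estimates
  have h1 : 𝔼 k, gauge c D (critLog D (softRatio y k - 1) - critLog D (softRatio y i - 1))
      ≤ Real.exp (x - X) * G - 1 + (2 * (x - 1) ^ 2 - 4 * c * (x - 1)) / (2 * D)
        + K0 * c ^ 3 / D := by
    have h2 : ∀ k, gauge c D (critLog D (softRatio y k - 1) - critLog D (softRatio y i - 1))
        ≤ Real.exp (softRatio y i - softRatio y k)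
          + ((4 * c - 2 * (x - 1)) / (2 * D) * (softRatio y k - 1)
          + (-1 + (2 * (x - 1) ^ 2 - 4 * c * (x - 1)) / (2 * D) + K0 * c ^ 3 / D)) := by
      intro k
      refine (hgauge c D (softRatio y i - 1) (softRatio y k - 1) hc hc2 hD1 hDB (hδ i)
        (hδ k)).trans (le_of_eq ?_)
      rw [← hx, sub_sub_sub_cancel_right]
      field_simp
      ring
    refine (Finset.expect_le_expect fun k _ => h2 k).trans ?_
    rw [Finset.expect_add_distrib, Finset.expect_add_distrib, ← Finset.mul_expect,
      Finset.expect_sub_distrib, expect_softRatio, Fintype.expect_const, Fintype.expect_const]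
    linarith
  -- the gap to the extremal value
  have hζ : Real.exp (x - X) * G ≤ G - (X - x) / (1 + Z) := by
    have h3 : Real.exp (x - X) ≤ 1 / (1 + (X - x)) := by
      rw [show x - X = -(X - x) by ring, Real.exp_neg, ← one_div]
      apply one_div_le_one_div_of_le (by linarith)
      linarith [Real.add_one_le_exp (X - x)]
    have h4 : 1 / (1 + (X - x)) = 1 - (X - x) / (1 + (X - x)) := by
      have : 1 + (X - x) ≠ 0 := by linarith
      field_simp; ring
    have h5 : (X - x) / (1 + Z) ≤ (X - x) / (1 + (X - x)) := by
      apply div_le_div_of_nonneg_left <;> linarith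
    have h6 : (X - x) / (1 + Z) ≤ 1 - Real.exp (x - X) := by linarith
    have h7 : 1 * (1 - Real.exp (x - X)) ≤ G * (1 - Real.exp (x - X)) := by
      apply mul_le_mul_of_nonneg_right hG1
      rw [sub_nonneg]; apply Real.exp_le_one_iff.2; linarith
    linarith
  have hXc : |X - 1 - c| ≤ K1 * c ^ 2 := by
    have h3 : X - 1 - c = ((Real.exp c - 1 - c) - (1 + c) * (M - 1)) / M := by
      rw [hX]; field_simp; ring
    rw [h3, abs_div, abs_of_pos hM0]
    refine (div_le_self (abs_nonneg _) hM1).trans ((abs_sub _ _).trans ?_)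
    have h4 := abs_exp_sub_one_sub_le (t := c) (r := 2) (by rwa [abs_of_nonneg hc])
    rw [← hZ] at h4
    have h5 : |(1 + c) * (M - 1)| ≤ 3 * (E * (Q * c) ^ 2) := by
      rw [abs_of_nonneg (mul_nonneg (by linarith) (by linarith))]
      exact mul_le_mul (by linarith) hM2 (by linarith) (by norm_num)
    refine (add_le_add h4 h5).trans (le_of_eq ?_)
    rw [hK1]; ring
  have hXc2 : (X - 1 - c) ^ 2 ≤ 2 * K1 ^ 2 * c ^ 3 := by
    rw [← sq_abs]
    calc |X - 1 - c| ^ 2 ≤ (K1 * c ^ 2) ^ 2 := by gcongr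
      _ = K1 ^ 2 * c ^ 3 * c := by ring
      _ ≤ K1 ^ 2 * c ^ 3 * 2 := by gcongr
      _ = _ := by ring
  have hsq : (x - 1 - c) ^ 2 / D ≤ (X - x) / (1 + Z) + 4 * K1 ^ 2 * c ^ 3 / D := by
    have h3 : (x - 1 - c) ^ 2 ≤ 2 * (X - x) ^ 2 + 2 * (X - 1 - c) ^ 2 := by
      linarith only [sq_nonneg ((X - x) + (X - 1 - c))]
    have h4 : 2 * (X - x) ^ 2 / D ≤ (X - x) / (1 + Z) := by
      rw [div_le_div_iff₀ hD0 (by linarith)]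
      have h5 : (X - x) * (2 * Z * (1 + Z)) ≤ (X - x) * D := by
        apply mul_le_mul_of_nonneg_left hDZ; linarith
      have h6 : (X - x) * (X - x) ≤ (X - x) * Z := by
        apply mul_le_mul_of_nonneg_left <;> linarith
      have h7 : (X - x) * (X - x) * (1 + Z) ≤ (X - x) * Z * (1 + Z) := by gcongr
      linarith
    calc (x - 1 - c) ^ 2 / D ≤ (2 * (X - x) ^ 2 + 2 * (2 * K1 ^ 2 * c ^ 3)) / D := by
          gcongr; linarith
      _ = 2 * (X - x) ^ 2 / D + 4 * K1 ^ 2 * c ^ 3 / D := by ring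
      _ ≤ _ := by gcongr
  have e : (2 * (x - 1) ^ 2 - 4 * c * (x - 1)) / (2 * D) + c ^ 2 / D = (x - 1 - c) ^ 2 / D := by
    field_simp; ring
  have e2 : (K0 + 4 * K1 ^ 2) * c ^ 3 / D = K0 * c ^ 3 / D + 4 * K1 ^ 2 * c ^ 3 / D := by ring
  rw [← hG, e2]
  linarith

/-! ### The second step -/

/-- The second step takes the sublevel sets of the averaged gauge into a simplex of balanced messages.
Here `w` is the logarithm of the message, normalized to vanish at the color `i`. -/
theorem exists_critLog_sub_expect_le (ι : Type*) [Fintype ι] [Nonempty ι] {B : ℝ} (hB : 0 ≤ B) :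
    ∃ K D₀ : ℝ, 0 ≤ K ∧ 1 ≤ D₀ ∧ ∀ (c D θ : ℝ) (w : ι → ℝ) (i : ι),
      0 ≤ c → c ≤ 2 → D₀ ≤ D → w i = 0 → (∀ k, |w k| ≤ B * c) →
      (𝔼 k, gauge c D (w k)) + c ^ 2 / D ≤ θ →
      critLog D (softRatio w i - 1) - 𝔼 k, critLog D (softRatio w k - 1)
        ≤ 1 - 1 / (1 + θ) + K * c ^ 3 / D := by
  obtain ⟨E, hE⟩ : ∃ E, E = Real.exp (B * 2) := ⟨_, rfl⟩
  have hE1 : 1 ≤ E := by rw [hE]; exact Real.one_le_exp (by positivity)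
  have hE0 : 0 < E := by linarith
  obtain ⟨B', hB'⟩ : ∃ B', B' = 2 * E ^ 2 * B := ⟨_, rfl⟩
  have hB'0 : 0 ≤ B' := by rw [hB']; positivity
  refine ⟨4 * B' ^ 3 + 4 * E ^ 3 * (E * B) ^ 4, 1 + 4 * B' + 8 * E ^ 3 * B ^ 2, by positivity, ?_, ?_⟩
  · have : 0 ≤ 4 * B' + 8 * E ^ 3 * B ^ 2 := by positivity
    linarith
  intro c D θ w i hc hc2 hD hwi hw hθ
  have hEB : 0 ≤ 8 * E ^ 3 * B ^ 2 := by positivity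
  have hD1 : 1 ≤ D := by linarith
  have hDB : 4 * B' ≤ D := by linarith
  have hDE : 8 * E ^ 3 * B ^ 2 ≤ D := by linarith
  have hD0 : 0 < D := by linarith
  clear hD
  have hBc : B * c ≤ B * 2 := by gcongr
  obtain ⟨h, hh⟩ : ∃ h, h = 𝔼 k, Real.exp (w k) := ⟨_, rfl⟩
  obtain ⟨S, hS⟩ : ∃ S, S = 𝔼 k, (Real.exp (w k) - 1) ^ 2 := ⟨_, rfl⟩
  have hh0 : 0 < h := hh ▸ expect_exp_pos w
  have hω : ∀ k, |Real.exp (w k) - 1| ≤ E * B * c := by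
    intro k
    rw [mul_assoc, hE]
    refine (abs_exp_sub_one_le ((hw k).trans hBc)).trans ?_
    gcongr
    exact hw k
  have hv : 𝔼 k, (Real.exp (w k) - 1) = h - 1 := by
    rw [Finset.expect_sub_distrib, ← hh, Fintype.expect_const]
  have hv1 : |h - 1| ≤ E * B * c := hv ▸ abs_expect_le hω
  have hhE : 1 / E ≤ h := by
    rw [hh]
    refine Finset.le_expect Finset.univ_nonempty fun k _ => ?_
    rw [hE, one_div, ← Real.exp_neg]
    exact Real.exp_le_exp.2 (by linarith [neg_le_of_abs_le (hw k)])
  have h1E : 1 / h ≤ E := by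
    rw [div_le_iff₀ hh0]
    rwa [div_le_iff₀ hE0, mul_comm] at hhE
  have hS0 : 0 ≤ S := hS ▸ Finset.expect_nonneg fun k _ => sq_nonneg _
  have hS1 : S ≤ (E * B * c) ^ 2 := by
    rw [hS]
    refine Finset.expect_le Finset.univ_nonempty fun k _ => ?_
    rw [← sq_abs]
    gcongr
    exact hω k
  have hvsq : (h - 1) ^ 2 ≤ (E * B * c) ^ 2 := by rw [← sq_abs]; gcongr
  have hδe : ∀ k, softRatio w k - 1 = ((Real.exp (w k) - 1) - (h - 1)) * (1 / h) := by
    intro k; rw [softRatio, ← hh]; field_simp; ring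
  have hδ : ∀ k, |softRatio w k - 1| ≤ B' * c := by
    intro k
    rw [hδe, abs_mul, abs_of_pos (one_div_pos.2 hh0)]
    have h2 := (abs_sub (Real.exp (w k) - 1) (h - 1)).trans (add_le_add (hω k) hv1)
    calc _ ≤ (E * B * c + E * B * c) * E := by gcongr
      _ = _ := by rw [hB']; ring
  have hB'c : B' * c ≤ B' * 2 := by gcongr
  have hz : ∀ k, |critLog D (softRatio w k - 1) + (softRatio w k - 1)
      + (softRatio w k - 1) ^ 2 / (2 * D)| ≤ 2 * B' ^ 3 * c ^ 3 / D := by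
    intro k
    refine (abs_critLog_add_le hD1 (by linarith [hδ k])).trans ?_
    rw [mul_assoc, ← mul_pow]
    gcongr
    exact hδ k
  -- `T` is the correction of order `c ^ 2 / D` coming from the second-order term of `critLog`
  obtain ⟨T, hT⟩ : ∃ T, T = (S - 2 * (h - 1) ^ 2) / (2 * D) := ⟨_, rfl⟩
  have hΨ : critLog D (softRatio w i - 1) - 𝔼 k, critLog D (softRatio w k - 1)
      ≤ 1 - 1 / h + T / h ^ 2 + 4 * B' ^ 3 * c ^ 3 / D := by
    have h2 := (abs_le.1 (hz i)).2
    have h3 : 𝔼 k, (-(2 * B' ^ 3 * c ^ 3 / D) - (softRatio w k - 1)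
        - (1 / h ^ 2 / (2 * D)) * ((Real.exp (w k) - 1) ^ 2 - 2 * (h - 1) * (Real.exp (w k) - 1)
          + (h - 1) ^ 2)) ≤ 𝔼 k, critLog D (softRatio w k - 1) := by
      refine Finset.expect_le_expect fun k _ => ?_
      have h4 := (abs_le.1 (hz k)).1
      have h5 : (softRatio w k - 1) ^ 2 / (2 * D) = (1 / h ^ 2 / (2 * D)) *
          ((Real.exp (w k) - 1) ^ 2 - 2 * (h - 1) * (Real.exp (w k) - 1) + (h - 1) ^ 2) := by
        rw [hδe]; field_simp; ring
      linarith
    rw [Finset.expect_sub_distrib, Finset.expect_sub_distrib, ← Finset.mul_expect,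
      Finset.expect_add_distrib, Finset.expect_sub_distrib, Finset.expect_sub_distrib,
      ← Finset.mul_expect, expect_softRatio, hv, ← hS] at h3
    simp only [Fintype.expect_const] at h3
    have h6 : (softRatio w i - 1) = 1 / h - 1 := by
      rw [hδe, hwi, Real.exp_zero]; field_simp; ring
    rw [h6] at h2 ⊢
    have h7 : T / h ^ 2 = (1 / h ^ 2 / (2 * D)) * (S - 2 * (h - 1) * (h - 1) + (h - 1) ^ 2)
        - (1 / h - 1) ^ 2 / (2 * D) := by
      rw [hT]; field_simp; ring
    have h8 : 4 * B' ^ 3 * c ^ 3 / D = 2 * (2 * B' ^ 3 * c ^ 3 / D) := by ring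
    rw [h7, h8]
    linarith
  have hTabs : |T| ≤ (E * B * c) ^ 2 / D := by
    rw [hT, abs_div, abs_of_pos (by positivity : 0 < 2 * D), div_le_div_iff₀ (by positivity) hD0]
    have : |S - 2 * (h - 1) ^ 2| ≤ 2 * (E * B * c) ^ 2 := by
      rw [abs_le]; constructor <;> linarith [sq_nonneg (h - 1)]
    calc _ ≤ 2 * (E * B * c) ^ 2 * D := by gcongr
      _ = _ := by ring
  have hTh : |T| ≤ h / 2 := by
    refine hTabs.trans (le_trans ?_ (show 1 / E / 2 ≤ h / 2 by linarith))
    rw [div_div, div_le_div_iff₀ hD0 (by positivity), one_mul]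
    refine le_trans ?_ hDE
    calc (E * B * c) ^ 2 * (E * 2) ≤ (E * B * 2) ^ 2 * (E * 2) := by gcongr
      _ = _ := by ring
  have hhT : h / 2 ≤ h + T := by linarith [neg_le_of_abs_le hTh]
  have hhT0 : 0 < h + T := by linarith
  have hTT : T ^ 2 / (h ^ 2 * (h + T)) ≤ 4 * E ^ 3 * (E * B) ^ 4 * c ^ 3 / D := by
    have h2 : T ^ 2 / (h ^ 2 * (h + T)) ≤ T ^ 2 / (h ^ 2 * (h / 2)) := by gcongr
    have h3 : T ^ 2 / (h ^ 2 * (h / 2)) = 2 * T ^ 2 * (1 / h) ^ 3 := by field_simp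
    have h4 : T ^ 2 ≤ 2 * (E * B) ^ 4 * c ^ 3 / D := by
      rw [← sq_abs]
      calc |T| ^ 2 ≤ ((E * B * c) ^ 2 / D) ^ 2 := by gcongr
        _ = (E * B) ^ 4 * c ^ 3 * c / D / D := by field_simp
        _ ≤ (E * B) ^ 4 * c ^ 3 * c / D := div_le_self (by positivity) hD1
        _ ≤ (E * B) ^ 4 * c ^ 3 * 2 / D := by gcongr
        _ = _ := by ring
    calc _ ≤ 2 * T ^ 2 * (1 / h) ^ 3 := h2.trans h3.le
      _ ≤ 2 * (2 * (E * B) ^ 4 * c ^ 3 / D) * E ^ 3 := by gcongr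
      _ = _ := by ring
  have hθT : h + T ≤ 1 + θ := by
    -- the constant `c ^ 2 / D` and the linear term of the gauge complete the square
    have h2 : (𝔼 k, gauge c D (w k)) + c ^ 2 / D = (h - 1) + T + (h - 1 - c) ^ 2 / D := by
      simp only [gauge]
      rw [Finset.expect_add_distrib, ← Finset.mul_expect, ← Finset.expect_div, hv, ← hS, hT]
      field_simp; ring
    have h3 : 0 ≤ (h - 1 - c) ^ 2 / D := by positivity
    linarith
  have hmono : 1 / (1 + θ) ≤ 1 / (h + T) := one_div_le_one_div_of_le hhT0 hθT
  -- replacing `1 / h - T / h ^ 2` by `1 / (h + T)` costs only `O(T ^ 2) = O(c ^ 3 / D)`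
  have e1 : 1 - 1 / h + T / h ^ 2 = 1 - 1 / (h + T) + T ^ 2 / (h ^ 2 * (h + T)) := by
    field_simp; ring
  have e2 : (4 * B' ^ 3 + 4 * E ^ 3 * (E * B) ^ 4) * c ^ 3 / D
      = 4 * B' ^ 3 * c ^ 3 / D + 4 * E ^ 3 * (E * B) ^ 4 * c ^ 3 / D := by ring
  rw [e2]
  linarith

end TwoStep

section TwoStep

variable {ι κ : Type*} [Fintype ι] [Nonempty ι] [Fintype κ] [Nonempty κ]

/-! ### The recursion on normalized messages -/

/-- The normalized messages whose centered logarithm is at most `c` in every coordinate. In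
logarithmic coordinates this is a simplex around the uniform message. -/
def IsBalanced (c : ℝ) (x : ι → ℝ) : Prop :=
  ∃ y : ι → ℝ, 𝔼 k, y k = 0 ∧ (∀ k, y k ≤ c) ∧ x = softRatio y

/-- The message sent by a vertex whose children, indexed by `κ`, send the messages `x a`. -/
noncomputable def treeStep (D β : ℝ) (x : κ → ι → ℝ) : ι → ℝ :=
  softRatio fun k => β * 𝔼 a, critLog D (x a k - 1)

/-- Balancedness is linear in logarithmic coordinates, so it is inherited from the children. -/
theorem isBalanced_treeStep {D β c : ℝ} {x : κ → ι → ℝ} (hβ : 0 ≤ β)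
    (h : ∀ a i, critLog D (x a i - 1) - 𝔼 k, critLog D (x a k - 1) ≤ c) :
    IsBalanced (β * c) (treeStep D β x) := by
  refine ⟨fun i => (β * 𝔼 a, critLog D (x a i - 1)) - 𝔼 k, (β * 𝔼 a, critLog D (x a k - 1)),
    ?_, fun i => ?_, ?_⟩
  · rw [Finset.expect_sub_distrib, Fintype.expect_const, sub_self]
  · dsimp only
    rw [← Finset.mul_expect, Finset.expect_comm, ← mul_sub, ← Finset.expect_sub_distrib]
    gcongr
    exact Finset.expect_le Finset.univ_nonempty fun a _ => h a i
  · rw [softRatio_sub_const]; rfl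

/-- Jensen's inequality for a mean with part of the mass moved to `0`. -/
theorem map_mul_expect_le {f : ℝ → ℝ} (hf : ConvexOn ℝ Set.univ f) (hf0 : f 0 = 0) {β : ℝ}
    (hβ : 0 ≤ β) (hβ1 : β ≤ 1) (g : κ → ℝ) : f (β * 𝔼 a, g a) ≤ β * 𝔼 a, f (g a) := by
  have h1 : f (𝔼 a, g a) ≤ 𝔼 a, f (g a) := by
    have := hf.map_sum_le (t := Finset.univ) (w := fun _ : κ => (1 : ℝ) / Fintype.card κ)
      (p := g) (fun _ _ => by positivity) (by simp) (fun _ _ => Set.mem_univ _)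
    simp only [smul_eq_mul, ← Finset.mul_sum] at this
    rw [Fintype.expect_eq_sum_div_card, Fintype.expect_eq_sum_div_card]
    simpa [div_eq_inv_mul] using this
  have h2 := hf.2 (Set.mem_univ (𝔼 a, g a)) (Set.mem_univ 0) hβ (sub_nonneg.2 hβ1)
    (by ring)
  simp only [smul_eq_mul, mul_zero, add_zero, hf0] at h2
  exact h2.trans (by gcongr)

theorem exists_abs_sub_one_le (ι : Type*) [Fintype ι] [Nonempty ι] (R : ℝ) (hR : 0 ≤ R) :
    ∃ B : ℝ, 0 ≤ B ∧ ∀ (c : ℝ) (x : ι → ℝ), c ≤ R → IsBalanced c x →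
      ∀ k, |x k - 1| ≤ B * c := by
  refine ⟨Real.exp (Fintype.card ι * R) * (1 + Fintype.card ι * R) * Fintype.card ι,
    by positivity, ?_⟩
  rintro c x hc ⟨y, h0, hyc, rfl⟩ k
  rw [mul_assoc]
  exact abs_softRatio_sub_one_le h0 (by gcongr) (fun k => abs_le_of_expect_eq_zero h0 hyc k) k

theorem IsBalanced.nonneg {c : ℝ} {x : ι → ℝ} (h : IsBalanced c x) : 0 ≤ c := by
  obtain ⟨y, h0, hyc, -⟩ := h
  rw [← h0]
  exact Finset.expect_le Finset.univ_nonempty fun k _ => hyc k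

/-- Two steps of the recursion contract the simplices of balanced messages. -/
theorem exists_isBalanced_treeStep_treeStep (ι : Type*) [Fintype ι] [Nonempty ι] :
    ∃ D₀ : ℝ, 1 ≤ D₀ ∧ ∀ (κ : Type) [Fintype κ] [Nonempty κ] (c D β : ℝ) (x : κ → κ → ι → ℝ),
      c ≤ 2 → D₀ ≤ D → 0 ≤ β → β ≤ 1 → (∀ a b, IsBalanced c (x a b)) →
      IsBalanced (β * (c - c ^ 3 / 36)) (treeStep D β fun a => treeStep D β (x a)) := by
  obtain ⟨B, hB, hbal⟩ := exists_abs_sub_one_le ι 2 (by norm_num)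
  obtain ⟨KA, DA, hKA, hDA, hA⟩ := exists_expect_gauge_le ι
  obtain ⟨KB, DB, hKB, hDB, hBB⟩ := exists_critLog_sub_expect_le ι (B := 4 * B) (by positivity)
  have hK0 : 0 ≤ 36 * (KA + KB) := by positivity
  refine ⟨5 + DA + DB + 4 * B + 36 * (KA + KB), by linarith, ?_⟩
  intro κ _ _ c D β x hc2 hD hβ hβ1 hx
  obtain ⟨a₀⟩ := (inferInstance : Nonempty κ)
  have hc : 0 ≤ c := (hx a₀ a₀).nonneg
  have hD5 : 5 ≤ D := by linarith
  have hD0 : 0 < D := by linarith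
  have hDK : 36 * (KA + KB) ≤ D := by linarith
  have hD2B : 4 * B ≤ D := by linarith
  refine isBalanced_treeStep hβ fun a i => ?_
  obtain ⟨z, hz⟩ : ∃ z : κ → ι → ℝ, z = fun b k => critLog D (x a b k - 1) := ⟨_, rfl⟩
  -- log-message after the first step, normalized to vanish at the color `i`
  obtain ⟨w, hw⟩ : ∃ w : ι → ℝ, w = fun k => β * 𝔼 b, (z b k - z b i) := ⟨_, rfl⟩
  have hstep : treeStep D β (x a) = softRatio w := by
    rw [hw, hz]
    simp only [Finset.expect_sub_distrib, mul_sub]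
    exact (softRatio_sub_const _ _).symm
  have hBc : B * c ≤ B * 2 := by gcongr
  have hzabs : ∀ b k, |z b k| ≤ 2 * (B * c) := by
    intro b k
    have h1 := hbal c _ hc2 (hx a b) k
    rw [hz]
    exact (abs_critLog_le (by linarith) (by linarith)).trans (by gcongr)
  have hwabs : ∀ k, |w k| ≤ 4 * B * c := by
    intro k
    rw [hw]
    simp only [abs_mul, abs_of_nonneg hβ]
    refine (mul_le_of_le_one_left (abs_nonneg _) hβ1).trans (abs_expect_le fun b => ?_)
    refine (abs_sub _ _).trans ?_
    linarith [hzabs b k, hzabs b i]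
  have hwi : w i = 0 := by simp [hw]
  obtain ⟨G, hG⟩ : ∃ G, G = Real.exp (Real.exp c - 1) := ⟨_, rfl⟩
  have hGc : 1 + (c + c ^ 2 / 2) ≤ G := by
    have h1 := Real.quadratic_le_exp_of_nonneg hc
    have h2 := Real.add_one_le_exp (Real.exp c - 1)
    rw [hG]; linarith
  have hKc : 0 ≤ KA * c ^ 3 / D := by positivity
  have hcD : c ^ 2 / D ≤ c ^ 2 / 2 := by gcongr; linarith
  have hθ : (𝔼 k, gauge c D (w k)) + c ^ 2 / D ≤ G - 1 + KA * c ^ 3 / D := by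
    have h1 : 𝔼 k, gauge c D (w k) ≤ 𝔼 k, (β * 𝔼 b, gauge c D (z b k - z b i)) := by
      refine Finset.expect_le_expect fun k _ => ?_
      rw [hw]
      exact map_mul_expect_le (convexOn_gauge hD0 (by linarith)) (by simp [gauge]) hβ hβ1 _
    rw [← Finset.mul_expect, Finset.expect_comm] at h1
    have h2 : 𝔼 b, 𝔼 k, gauge c D (z b k - z b i) ≤ G - 1 + KA * c ^ 3 / D - c ^ 2 / D := by
      refine Finset.expect_le Finset.univ_nonempty fun b _ => ?_
      obtain ⟨y, h0, hyc, hy⟩ := hx a b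
      have := hA c D y i hc hc2 (by linarith) h0 hyc
      rw [← hy, ← hG] at this
      rw [hz]
      linarith
    have h3 : β * 𝔼 b, 𝔼 k, gauge c D (z b k - z b i)
        ≤ β * (G - 1 + KA * c ^ 3 / D - c ^ 2 / D) := by gcongr
    have h4 : β * (G - 1 + KA * c ^ 3 / D - c ^ 2 / D) ≤ G - 1 + KA * c ^ 3 / D - c ^ 2 / D :=
      mul_le_of_le_one_left (by linarith) hβ1
    linarith
  have h1 := hBB c D _ w i hc hc2 (by linarith) hwi hwabs hθ
  simp only [hstep]
  refine h1.trans ?_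
  have h2 : 1 / G - KA * c ^ 3 / D ≤ 1 / (1 + (G - 1 + KA * c ^ 3 / D)) := by
    have hG1 : 1 ≤ G := by linarith [sq_nonneg c]
    have hG0 : 0 < G := by linarith
    generalize KA * c ^ 3 / D = t at hKc ⊢
    rw [show 1 + (G - 1 + t) = G + t by ring]
    have h3 : 1 / G - 1 / (G + t) = t / (G * (G + t)) := by
      have : G + t ≠ 0 := by linarith
      field_simp; ring
    have h4 : t / (G * (G + t)) ≤ t := div_le_self hKc (by nlinarith)
    linarith
  have h3 : 1 / G = Real.exp (1 - Real.exp c) := by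
    rw [hG, one_div, ← Real.exp_neg, neg_sub]
  have h4 := one_sub_exp_le hc hc2
  have h5 : KA * c ^ 3 / D + KB * c ^ 3 / D ≤ c ^ 3 / 36 := by
    rw [← add_div, ← add_mul, div_le_div_iff₀ hD0 (by norm_num)]
    have : c ^ 3 * (36 * (KA + KB)) ≤ c ^ 3 * D := by gcongr
    linarith
  linarith

/-- A single step changes the size of the simplex by at most a constant factor. -/
theorem exists_isBalanced_treeStep (ι : Type*) [Fintype ι] [Nonempty ι] :
    ∃ L D₀ : ℝ, 0 ≤ L ∧ 1 ≤ D₀ ∧ ∀ (κ : Type) [Fintype κ] [Nonempty κ] (c D β : ℝ) (x : κ → ι → ℝ),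
      c ≤ 2 → D₀ ≤ D → 0 ≤ β → (∀ a, IsBalanced c (x a)) →
      IsBalanced (β * (L * c)) (treeStep D β x) := by
  obtain ⟨B, hB, hbal⟩ := exists_abs_sub_one_le ι 2 (by norm_num)
  refine ⟨4 * B, 1 + 4 * B, by positivity, by linarith, ?_⟩
  intro κ _ _ c D β x hc2 hD hβ hx
  refine isBalanced_treeStep hβ fun a i => ?_
  have hBc : B * c ≤ B * 2 := by gcongr
  have h1 : ∀ k, |critLog D (x a k - 1)| ≤ 2 * (B * c) := by
    intro k
    have h1 := hbal c _ hc2 (hx a) k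
    exact (abs_critLog_le (by linarith) (by linarith)).trans (by gcongr)
  have h2 := abs_expect_le h1
  linarith [le_of_abs_le (h1 i), neg_le_of_abs_le h2]

/-- The messages of vertices whose children all have a prescribed color. -/
theorem isBalanced_treeStep_single [DecidableEq ι] {D β : ℝ} (t : κ → ι) (hβ : 0 ≤ β)
    (hD : 1 + 2 * Fintype.card ι + 5 * (Fintype.card ι : ℝ) ^ 3 ≤ D) :
    IsBalanced (β * 2)
      (treeStep D β fun a k => (Fintype.card ι : ℝ) * if t a = k then 1 else 0) := by
  obtain ⟨Q, hQ⟩ : ∃ Q : ℝ, Q = Fintype.card ι := ⟨_, rfl⟩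
  have hQ1 : 1 ≤ Q := by rw [hQ]; exact_mod_cast Fintype.card_pos (α := ι)
  rw [← hQ] at hD ⊢
  have hQ3 : 0 ≤ Q ^ 3 := by positivity
  have hD1 : 1 ≤ D := by linarith
  have hD0 : 0 < D := by linarith
  refine isBalanced_treeStep hβ fun a i => ?_
  have hempty : critLog D (0 - 1) ≤ 1 ∧ 0 ≤ critLog D (0 - 1) := by
    have hpos : 0 ≤ 1 / D := by positivity
    have e : 1 - (0 - 1) / D = 1 + 1 / D := by ring
    rw [critLog, e]
    constructor
    · have := Real.log_le_sub_one_of_pos (show 0 < 1 + 1 / D by linarith)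
      calc D * Real.log (1 + 1 / D) ≤ D * (1 / D) := by gcongr; linarith
        _ = 1 := by field_simp
    · exact mul_nonneg hD0.le (Real.log_nonneg (by linarith))
  have habs : |Q - 1| = Q - 1 := abs_of_nonneg (by linarith)
  have hfull : -Q ≤ critLog D (Q - 1) ∧ critLog D (Q - 1) ≤ 1 := by
    have h1 := abs_critLog_add_le (a := Q - 1) hD1 (by rw [habs]; linarith)
    rw [habs, abs_le] at h1
    have h2 : (Q - 1) ^ 2 / (2 * D) + 2 * (Q - 1) ^ 3 / D ≤ 1 := by
      have h3 : (Q - 1) ^ 2 / (2 * D) ≤ Q ^ 2 / D := by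
        rw [div_le_div_iff₀ (by positivity) hD0]
        have : (Q - 1) ^ 2 ≤ Q ^ 2 := by linarith
        have := mul_le_mul_of_nonneg_right this hD0.le
        have : 0 ≤ Q ^ 2 * D := by positivity
        linarith
      have h4 : 2 * (Q - 1) ^ 3 / D ≤ 2 * Q ^ 3 / D := by
        gcongr
        linarith
      have h5 : Q ^ 2 / D + 2 * Q ^ 3 / D ≤ 1 := by
        rw [← add_div, div_le_one hD0]
        have : Q ^ 2 ≤ Q ^ 3 := pow_le_pow_right₀ hQ1 (by norm_num)
        linarith
      linarith
    have h3 : 0 ≤ (Q - 1) ^ 2 / (2 * D) := by positivity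
    have h4 : 0 ≤ 2 * (Q - 1) ^ 3 / D := by
      have : 0 ≤ Q - 1 := by linarith
      positivity
    constructor <;> linarith [h1.1, h1.2]
  have hle : critLog D (Q * (if t a = i then 1 else 0) - 1) ≤ 1 := by
    split_ifs
    · rw [mul_one]; exact hfull.2
    · rw [mul_zero]; exact hempty.1
  have hge : 𝔼 k, (-(if t a = k then Q else 0))
      ≤ 𝔼 k, critLog D (Q * (if t a = k then 1 else 0) - 1) := by
    refine Finset.expect_le_expect fun k _ => ?_
    split_ifs
    · rw [mul_one]; exact hfull.1
    · rw [mul_zero, neg_zero]; exact hempty.2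
  have hsum : 𝔼 k, (-(if t a = k then Q else 0)) = -1 := by
    rw [Finset.expect_neg_distrib, Fintype.expect_eq_sum_div_card, Finset.sum_ite_eq,
      if_pos (Finset.mem_univ _), ← hQ, div_self (by linarith)]
  linarith

end TwoStep

section Tree

variable {d n q : ℕ}

/-! ### The recursion on the tree -/

/-- The vertex with address `v` in the subtree of the `a`-th child of the root. -/
def childVertex (a : Fin d) (v : TreeVertex d n) : TreeVertex d (n + 1) :=
  ⟨a :: v.1, by simpa using v.2⟩

/-- The parent of a vertex; the root is its own parent. -/
def parent (v : TreeVertex d n) : TreeVertex d n :=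
  ⟨v.1.dropLast, by simpa using v.2.trans (Nat.le_succ n)⟩

/-- The non-root vertices are the root of a subtree or lie deeper in one. -/
def vertexEquiv (d n : ℕ) : TreeVertex d (n + 1) ≃ Option (Fin d × TreeVertex d n) where
  toFun v := match v with
    | ⟨[], _⟩ => none
    | ⟨a :: l, h⟩ => some (a, ⟨l, by simpa using h⟩)
  invFun o := match o with
    | none => root d (n + 1)
    | some (a, v) => childVertex a v
  left_inv v := by
    obtain ⟨l, h⟩ := v
    cases l <;> rfl
  right_inv o := by
    rcases o with _ | ⟨a, v⟩ <;> rfl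

/-- A coloring of the tree is a color of the root with a coloring of each subtree. -/
def coloringEquiv (d n q : ℕ) :
    (TreeVertex d (n + 1) → Fin q) ≃ Fin q × (Fin d → TreeVertex d n → Fin q) where
  toFun φ := (φ (root d (n + 1)), fun a v => φ (childVertex a v))
  invFun p v := ((vertexEquiv d n v).elim p.1 fun u => p.2 u.1 u.2)
  left_inv φ := by
    funext v
    obtain ⟨l, h⟩ := v
    cases l <;> rfl
  right_inv p := rfl

open Classical in
/-- Edges correspond to non-root vertices, each joined to its parent. -/
theorem monoEdges_tree (φ : TreeVertex d n → Fin q) :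
    monoEdges (tree d n) φ = ∑ v, if v.1 ≠ [] ∧ φ (parent v) = φ v then 1 else 0 := by
  have hset : {e : Sym2 (TreeVertex d n) | e ∈ (tree d n).edgeSet ∧ (e.map φ).IsDiag}
      = (fun v => s(parent v, v)) '' {v | v.1 ≠ [] ∧ φ (parent v) = φ v} := by
    ext e
    induction e using Sym2.ind with
    | _ u v =>
      have key : ∀ u v : TreeVertex d n, (∃ a : Fin d, v.1 = u.1 ++ [a]) ↔
          v.1 ≠ [] ∧ u = parent v := by
        intro u v
        constructor
        · rintro ⟨a, ha⟩
          refine ⟨by simp [ha], Subtype.ext ?_⟩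
          simp [parent, ha]
        · rintro ⟨hne, rfl⟩
          exact ⟨v.1.getLast hne, (List.dropLast_append_getLast hne).symm⟩
      simp only [Set.mem_ofPred_eq, SimpleGraph.mem_edgeSet, Sym2.map_mk, Sym2.mk_isDiag_iff,
        Set.mem_image, Sym2.eq_iff]
      constructor
      · rintro ⟨h | h, hφ⟩
        · obtain ⟨hne, rfl⟩ := (key u v).1 h
          exact ⟨v, ⟨hne, hφ⟩, Or.inl ⟨rfl, rfl⟩⟩
        · obtain ⟨hne, rfl⟩ := (key v u).1 h
          exact ⟨u, ⟨hne, hφ.symm⟩, Or.inr ⟨rfl, rfl⟩⟩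
      · rintro ⟨x, ⟨hne, hφ⟩, ⟨rfl, rfl⟩ | ⟨rfl, rfl⟩⟩
        · exact ⟨Or.inl ((key _ _).2 ⟨hne, rfl⟩), hφ⟩
        · exact ⟨Or.inr ((key _ _).2 ⟨hne, rfl⟩), hφ.symm⟩
  have hinj : Set.InjOn (fun v : TreeVertex d n => s(parent v, v))
      {v | v.1 ≠ [] ∧ φ (parent v) = φ v} := by
    rintro u ⟨hu, -⟩ v - huv
    rcases Sym2.eq_iff.1 huv with ⟨-, h⟩ | ⟨h1, h2⟩
    · exact h
    · exfalso
      have e1 : u.1.dropLast.length = v.1.length := by rw [← h1]; rfl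
      have e2 : u.1.length = v.1.dropLast.length := by rw [h2]; rfl
      have := List.length_pos_iff.2 hu
      simp only [List.length_dropLast] at e1 e2
      omega
  rw [monoEdges, hset, hinj.ncard_image, Set.ncard_eq_toFinset_card',
    Set.toFinset_ofPred, Finset.card_filter]

theorem monoEdges_tree_succ (φ : TreeVertex d (n + 1) → Fin q) :
    monoEdges (tree d (n + 1)) φ = ∑ a, ((if φ (root d (n + 1)) = φ (childVertex a (root d n))
      then 1 else 0) + monoEdges (tree d n) fun v => φ (childVertex a v)) := by
  classical
  rw [monoEdges_tree, ← (vertexEquiv d n).symm.sum_comp, Fintype.sum_option, Fintype.sum_prod_type]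
  have h0 : ((vertexEquiv d n).symm none).1 = [] := rfl
  rw [if_neg (by simp [h0]), zero_add]
  refine Finset.sum_congr rfl fun a _ => ?_
  rw [monoEdges_tree, ← Finset.add_sum_erase _ _ (Finset.mem_univ (root d n)),
    ← Finset.add_sum_erase (a := root d n) _ (fun v : TreeVertex d n => if v.1 ≠ [] ∧ _ then 1 else 0)
      (Finset.mem_univ _)]
  have hr : (root d n).1 = [] := rfl
  have hc : ∀ v : TreeVertex d n, (vertexEquiv d n).symm (some (a, v)) = childVertex a v :=
    fun _ => rfl
  rw [if_neg (c := (root d n).1 ≠ [] ∧ _) (by simp [hr]), zero_add]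
  congr 1
  · rw [hc]
    have : parent (childVertex a (root d n)) = root d (n + 1) := rfl
    rw [this]
    exact if_congr (by simp [childVertex]) rfl rfl
  · refine Finset.sum_congr rfl fun v hv => ?_
    have hv : v.1 ≠ [] := fun h => (Finset.mem_erase.1 hv).1 (Subtype.ext h)
    have hp : parent (childVertex a v) = childVertex a (parent v) := by
      apply Subtype.ext
      simp [parent, childVertex, List.dropLast_cons_of_ne_nil hv]
    rw [hc, hp]
    simp [childVertex, hv]

theorem childVertex_mem_boundary (a : Fin d) {v : TreeVertex d n} (hv : v ∈ boundary d n) :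
    childVertex a v ∈ boundary d (n + 1) :=
  congrArg (· + 1) hv

/-- The boundary condition induced on the subtree of the `a`-th child of the root. -/
def childBoundary (τ : boundary d (n + 1) → Fin q) (a : Fin d) : boundary d n → Fin q :=
  fun v => τ ⟨childVertex a v.1, childVertex_mem_boundary a v.2⟩

open Classical in
/-- The total weight of the colorings with root color `i` that agree with `τ` on the boundary. -/
noncomputable def boundaryWeight (d n q : ℕ) (w : ℝ) (τ : boundary d n → Fin q) (i : Fin q) : ℝ :=
  ∑ φ : TreeVertex d n → Fin q,
    if φ (root d n) = i ∧ ∀ v : boundary d n, φ v = τ v then w ^ monoEdges (tree d n) φ else 0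

theorem forall_boundary_succ_iff (φ : TreeVertex d (n + 1) → Fin q)
    (τ : boundary d (n + 1) → Fin q) : (∀ v : boundary d (n + 1), φ v = τ v) ↔
      ∀ a, ∀ v : boundary d n, φ (childVertex a v) = childBoundary τ a v := by
  constructor
  · intro h a v
    exact h ⟨childVertex a v.1, childVertex_mem_boundary a v.2⟩
  · rintro h ⟨⟨l, hl⟩, hv⟩
    cases l with
    | nil => simp [boundary] at hv
    | cons a l =>
      have hl' : l.length = n := by simpa [boundary] using hv
      exact h a ⟨⟨l, hl'.le⟩, hl'⟩

theorem boundaryWeight_succ (w : ℝ) (τ : boundary d (n + 1) → Fin q) (i : Fin q) :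
    boundaryWeight d (n + 1) q w τ i
      = ∏ a, ∑ j, (if i = j then w else 1) * boundaryWeight d n q w (childBoundary τ a) j := by
  classical
  have h1 : ∀ a, ∑ j, (if i = j then w else 1) * boundaryWeight d n q w (childBoundary τ a) j
      = ∑ g : TreeVertex d n → Fin q, if ∀ v : boundary d n, g v = childBoundary τ a v then
        w ^ ((if i = g (root d n) then 1 else 0) + monoEdges (tree d n) g) else 0 := by
    intro a
    simp only [boundaryWeight, Finset.mul_sum]
    rw [Finset.sum_comm]
    refine Finset.sum_congr rfl fun g _ => ?_
    rw [Finset.sum_eq_single (g (root d n))]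
    · by_cases h : ∀ v : boundary d n, g v = childBoundary τ a v
      · simp only [h, implies_true, and_self, if_true, pow_add]
        split_ifs <;> simp
      · simp only [h, and_false, if_false, mul_zero]
    · intro j _ hj
      simp only [hj.symm, false_and, if_false, mul_zero]
    · simp
  simp only [h1]
  rw [Finset.prod_univ_sum, Fintype.piFinset_univ, boundaryWeight,
    ← (coloringEquiv d n q).symm.sum_comp, Fintype.sum_prod_type, Finset.sum_eq_single i]
  · refine Finset.sum_congr rfl fun f _ => ?_
    have hroot : (coloringEquiv d n q).symm (i, f) (root d (n + 1)) = i := rfl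
    have hchild : ∀ a v, (coloringEquiv d n q).symm (i, f) (childVertex a v) = f a v :=
      fun _ _ => rfl
    simp only [monoEdges_tree_succ, forall_boundary_succ_iff, hroot, hchild, true_and]
    by_cases h : ∀ a, ∀ v : boundary d n, f a v = childBoundary τ a v
    · rw [if_pos h, ← Finset.prod_pow_eq_pow_sum]
      exact Finset.prod_congr rfl fun a _ => (if_pos (h a)).symm
    · rw [if_neg h]
      obtain ⟨a, ha⟩ := not_forall.1 h
      exact (Finset.prod_eq_zero (Finset.mem_univ a) (if_neg ha)).symm
  · intro j _ hj
    refine Finset.sum_eq_zero fun f _ => if_neg fun h => hj ?_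
    exact h.1
  · simp

theorem boundaryWeight_nonneg {w : ℝ} (hw : 0 < w) (τ : boundary d n → Fin q) (i : Fin q) :
    0 ≤ boundaryWeight d n q w τ i := by
  refine Finset.sum_nonneg fun φ _ => ?_
  split_ifs
  · positivity
  · exact le_rfl

theorem sum_boundaryWeight_pos [NeZero q] {w : ℝ} (hw : 0 < w) (τ : boundary d n → Fin q) :
    0 < ∑ i, boundaryWeight d n q w τ i := by
  classical
  obtain ⟨φ, hφ⟩ : ∃ φ : TreeVertex d n → Fin q, ∀ v : boundary d n, φ v = τ v :=
    ⟨fun v => if h : v ∈ boundary d n then τ ⟨v, h⟩ else 0, fun v => by simp⟩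
  refine Finset.sum_pos' (fun i _ => boundaryWeight_nonneg hw τ i)
    ⟨φ (root d n), Finset.mem_univ _, ?_⟩
  refine Finset.sum_pos' (fun ψ _ => ?_) ⟨φ, Finset.mem_univ _, ?_⟩
  · split_ifs
    · positivity
    · exact le_rfl
  · rw [if_pos ⟨rfl, hφ⟩]; positivity

theorem partitionFunction_pos {V : Type*} [Fintype V] (G : SimpleGraph V) [NeZero q] {w : ℝ}
    (hw : 0 < w) : 0 < partitionFunction G q w := by
  classical
  exact Finset.sum_pos (fun σ _ => by positivity) ⟨fun _ => 0, Finset.mem_univ _⟩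

theorem rootProb_eq_div [NeZero q] {w : ℝ} (hw : 0 < w) (τ : boundary d n → Fin q) (i : Fin q) :
    rootProb d n q w τ i = boundaryWeight d n q w τ i / ∑ j, boundaryWeight d n q w τ j := by
  classical
  have hZ := (partitionFunction_pos (q := q) (tree d n) hw).ne'
  have h1 : ∀ A : Set (TreeVertex d n → Fin q), prob (tree d n) q w A
      = (∑ φ : TreeVertex d n → Fin q, if φ ∈ A then w ^ monoEdges (tree d n) φ else 0)
        / partitionFunction (tree d n) q w := by
    intro A
    rw [prob, Finset.sum_filter, Finset.sum_div]
    refine Finset.sum_congr (Finset.ext fun _ => by simp) fun φ _ => ?_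
    simp only [gibbs]
    split_ifs <;> simp
  rw [rootProb, condProb, h1, h1, div_div_div_cancel_right₀ hZ]
  have h2 : ∀ φ : TreeVertex d n → Fin q,
      (φ ∈ {φ | φ (root d n) = i} ∩ {φ | ∀ v : boundary d n, φ v = τ v}) ↔
        (φ (root d n) = i ∧ ∀ v : boundary d n, φ v = τ v) := fun _ => Iff.rfl
  refine congrArg₂ _ (Finset.sum_congr rfl fun φ _ => ?_) ?_
  · by_cases h : φ (root d n) = i ∧ ∀ v : boundary d n, φ v = τ v
    · rw [if_pos ((h2 φ).2 h), if_pos h]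
    · rw [if_neg (mt (h2 φ).1 h), if_neg h]
  simp only [boundaryWeight]
  rw [Finset.sum_comm]
  refine Finset.sum_congr rfl fun φ _ => ?_
  rw [Finset.sum_eq_single (φ (root d n))]
  · simp
  · intro j _ hj
    rw [if_neg (fun h => hj h.1.symm)]
  · simp

theorem rootProb_nonneg [NeZero q] {w : ℝ} (hw : 0 < w) (τ : boundary d n → Fin q) (i : Fin q) :
    0 ≤ rootProb d n q w τ i := by
  rw [rootProb_eq_div hw]
  exact div_nonneg (boundaryWeight_nonneg hw τ i) (sum_boundaryWeight_pos hw τ).le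

theorem sum_rootProb [NeZero q] {w : ℝ} (hw : 0 < w) (τ : boundary d n → Fin q) :
    ∑ i, rootProb d n q w τ i = 1 := by
  simp only [rootProb_eq_div hw]
  rw [← Finset.sum_div, div_self (sum_boundaryWeight_pos hw τ).ne']

theorem rootProb_le_one [NeZero q] {w : ℝ} (hw : 0 < w) (τ : boundary d n → Fin q) (i : Fin q) :
    rootProb d n q w τ i ≤ 1 := by
  rw [← sum_rootProb hw τ]
  exact Finset.single_le_sum (fun j _ => rootProb_nonneg hw τ j) (Finset.mem_univ i)

theorem rootProb_zero [NeZero q] {w : ℝ} (hw : 0 < w) (τ : boundary d 0 → Fin q) (i : Fin q) :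
    rootProb d 0 q w τ i = if τ ⟨root d 0, rfl⟩ = i then 1 else 0 := by
  classical
  have h : ∀ j, τ ⟨root d 0, rfl⟩ ≠ j → rootProb d 0 q w τ j = 0 := by
    intro j hj
    rw [rootProb_eq_div hw, boundaryWeight, Finset.sum_eq_zero, zero_div]
    intro φ _
    refine if_neg fun h => hj ?_
    rw [← h.1, ← h.2 ⟨root d 0, rfl⟩]
  split_ifs with hi
  · rw [← sum_rootProb hw τ, Finset.sum_eq_single i]
    · intro j _ hj
      exact h j (fun h' => hj (h'.symm.trans hi))
    · simp
  · exact h i hi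

theorem rootProb_succ [NeZero q] {w : ℝ} (hw : 0 < w) (τ : boundary d (n + 1) → Fin q)
    (i : Fin q) : rootProb d (n + 1) q w τ i
      = (∏ a, (1 - (1 - w) * rootProb d n q w (childBoundary τ a) i))
        / ∑ j, ∏ a, (1 - (1 - w) * rootProb d n q w (childBoundary τ a) j) := by
  have h1 : ∀ j, boundaryWeight d (n + 1) q w τ j
      = (∏ a, ∑ k, boundaryWeight d n q w (childBoundary τ a) k)
        * ∏ a, (1 - (1 - w) * rootProb d n q w (childBoundary τ a) j) := by
    intro j
    rw [boundaryWeight_succ, ← Finset.prod_mul_distrib]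
    refine Finset.prod_congr rfl fun a _ => ?_
    have hpos := (sum_boundaryWeight_pos hw (childBoundary τ a)).ne'
    have h2 : ∑ k, (if j = k then w else 1) * boundaryWeight d n q w (childBoundary τ a) k
        = (∑ k, boundaryWeight d n q w (childBoundary τ a) k)
          - (1 - w) * boundaryWeight d n q w (childBoundary τ a) j := by
      have h3 : ∀ k, (if j = k then w else 1) * boundaryWeight d n q w (childBoundary τ a) k
          = boundaryWeight d n q w (childBoundary τ a) k
            - if j = k then (1 - w) * boundaryWeight d n q w (childBoundary τ a) k else 0 := by
        intro k
        split_ifs <;> ring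
      simp only [h3]
      rw [Finset.sum_sub_distrib, Finset.sum_ite_eq, if_pos (Finset.mem_univ _)]
    rw [h2, rootProb_eq_div hw]
    field_simp
  rw [rootProb_eq_div hw]
  simp only [h1]
  rw [← Finset.mul_sum, mul_div_mul_left]
  exact Finset.prod_ne_zero_iff.2 fun a _ => (sum_boundaryWeight_pos hw _).ne'

end Tree

/-! ### Uniqueness -/

theorem IsBalanced.mono {ι : Type*} [Fintype ι] {c c' : ℝ} {x : ι → ℝ} (h : IsBalanced c x)
    (hc : c ≤ c') : IsBalanced c' x := by
  obtain ⟨y, h0, hy, rfl⟩ := h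
  exact ⟨y, h0, fun k => (hy k).trans hc, rfl⟩

/-- For the weight `1 - α q / (d + 1)`, one generation of the tree is one step of the recursion,
with parameter `D = (d + 1 - α) / α` and damping `β = d / D`. -/
theorem mul_rootProb_succ {d n q : ℕ} [NeZero q] [NeZero d] {α : ℝ} (hα : 0 < α) (hα1 : α ≤ 1)
    (hqd : q ≤ d) (τ : boundary d (n + 1) → Fin q) :
    (fun i => (q : ℝ) * rootProb d (n + 1) q (1 - α * q / (d + 1)) τ i)
      = treeStep ((d + 1 - α) / α) (d / ((d + 1 - α) / α)) fun a k =>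
        q * rootProb d n q (1 - α * q / (d + 1)) (childBoundary τ a) k := by
  have hq0 : (0 : ℝ) < q := by exact_mod_cast Nat.pos_of_ne_zero (NeZero.ne q)
  have hd0 : (0 : ℝ) < d := by exact_mod_cast Nat.pos_of_ne_zero (NeZero.ne d)
  have hqd' : (q : ℝ) ≤ d := by exact_mod_cast hqd
  obtain ⟨w, hw⟩ : ∃ w : ℝ, w = 1 - α * q / (d + 1) := ⟨_, rfl⟩
  have hαq : α * q ≤ q := mul_le_of_le_one_left hq0.le hα1
  have hw0 : 0 < w := by
    rw [hw, sub_pos, div_lt_one (by linarith)]; linarith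
  rw [← hw]
  have hb0 : 0 < d + 1 - α := by linarith
  obtain ⟨D, hD⟩ : ∃ D : ℝ, D = (d + 1 - α) / α := ⟨_, rfl⟩
  have hD0 : 0 < D := by rw [hD]; positivity
  obtain ⟨p, hp⟩ : ∃ p : Fin d → Fin q → ℝ, p = fun a k => rootProb d n q w (childBoundary τ a) k :=
    ⟨_, rfl⟩
  have hfac : ∀ a k, 1 - (1 - w) * p a k
      = (d + 1 - α) / (d + 1) * (1 - (q * p a k - 1) / D) := by
    intro a k
    rw [hw, hD]
    have : (d : ℝ) + 1 ≠ 0 := by positivity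
    field_simp
    ring
  have hpos : ∀ a k, 0 < 1 - (q * p a k - 1) / D := by
    intro a k
    have h1 : q * p a k ≤ q := by
      refine mul_le_of_le_one_right hq0.le ?_
      rw [hp]; exact rootProb_le_one hw0 _ _
    rw [sub_pos, div_lt_one hD0, hD, lt_div_iff₀ hα]
    have h2 : (q * p a k - 1) * α ≤ (q - 1) * α := by gcongr
    linarith
  have hexp : ∀ k, Real.exp (d / D * 𝔼 a, critLog D (q * p a k - 1))
      = ∏ a, (1 - (q * p a k - 1) / D) := by
    intro k
    rw [Fintype.expect_eq_sum_div_card, Fintype.card_fin]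
    simp only [critLog]
    rw [← Finset.mul_sum, show d / D * (D * (∑ a, Real.log (1 - (q * p a k - 1) / D)) / d)
      = ∑ a, Real.log (1 - (q * p a k - 1) / D) by field_simp, Real.exp_sum]
    exact Finset.prod_congr rfl fun a _ => Real.exp_log (hpos a k)
  funext i
  rw [← hD, treeStep, softRatio]
  have hp' : ∀ a k, rootProb d n q w (childBoundary τ a) k = p a k := fun a k => by rw [hp]
  rw [rootProb_succ hw0]
  simp only [hp', hexp, hfac, Finset.prod_mul_distrib, Finset.prod_const]
  rw [← Finset.mul_sum, Fintype.expect_eq_sum_div_card, Fintype.card_fin,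
    mul_div_mul_left _ _ (by positivity), div_div_eq_mul_div, mul_div_assoc', mul_comm]

/-- The sequence that bounds the messages at the critical weight. -/
noncomputable def criticalSeq : ℕ → ℝ
  | 0 => 2
  | k + 1 => criticalSeq k - criticalSeq k ^ 3 / 36

theorem criticalSeq_mem (k : ℕ) : 0 ≤ criticalSeq k ∧ criticalSeq k ≤ 2 := by
  induction k with
  | zero => simp [criticalSeq]
  | succ k ih =>
    obtain ⟨h0, h2⟩ := ih
    have h3 : criticalSeq k ^ 3 ≤ 4 * criticalSeq k := by
      have : criticalSeq k ^ 2 ≤ 2 ^ 2 := by gcongr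
      calc criticalSeq k ^ 3 = criticalSeq k ^ 2 * criticalSeq k := by ring
        _ ≤ 2 ^ 2 * criticalSeq k := by gcongr
        _ = _ := by ring
    have h4 : 0 ≤ criticalSeq k ^ 3 := by positivity
    simp only [criticalSeq]
    constructor <;> linarith

theorem tendsto_criticalSeq : Tendsto criticalSeq atTop (𝓝 0) := by
  have hanti : Antitone criticalSeq := antitone_nat_of_succ_le fun k => by
    have : 0 ≤ criticalSeq k ^ 3 := pow_nonneg (criticalSeq_mem k).1 3
    simp only [criticalSeq]
    linarith
  have hlim := tendsto_atTop_ciInf hanti ⟨0, by rintro _ ⟨k, rfl⟩; exact (criticalSeq_mem k).1⟩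
  generalize (⨅ k, criticalSeq k) = l at hlim
  have h1 : Tendsto (fun k => criticalSeq (k + 1)) atTop (𝓝 (l - l ^ 3 / 36)) :=
    hlim.sub ((hlim.pow 3).div_const 36)
  have h2 := tendsto_nhds_unique h1 (hlim.comp (tendsto_add_atTop_nat 1))
  have h3 : l ^ 3 = 0 := by linarith
  have h4 : l = 0 := by simpa using h3
  rwa [h4] at hlim

end Potts

open Potts in
theorem theorem1 (q : ℕ) (hq : 3 ≤ q) :
    ∃ C : ℝ, 0 < C ∧ ∃ d₀ : ℕ, 0 < d₀ ∧
      ∀ d : ℕ, d₀ ≤ d → ∀ α : ℝ, 0 < α → α < 1 → ∀ i : Fin q,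
        Tendsto (fun n : ℕ => ⨆ τ : Potts.boundary d n → Fin q,
            |Potts.rootProb d n q (Potts.criticalWeight q (d + 1)) τ i - 1 / (q : ℝ)|)
          atTop (𝓝 0) ∧
        ∀ (n : ℕ) (τ : Potts.boundary d n → Fin q),
          |Potts.rootProb d n q (1 - α * (q : ℝ) / ((d : ℝ) + 1)) τ i - 1 / (q : ℝ)|
            ≤ C * α ^ ((n : ℝ) / 2) := by
  have : NeZero q := ⟨by omega⟩
  have hq1 : (1 : ℝ) ≤ q := by exact_mod_cast (by omega : 1 ≤ q)
  have hq0 : (0 : ℝ) < q := by linarith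
  obtain ⟨D₁, hD₁, htwo⟩ := exists_isBalanced_treeStep_treeStep (Fin q)
  obtain ⟨L, D₂, hL, hD₂, hone⟩ := exists_isBalanced_treeStep (Fin q)
  obtain ⟨B, hB, hbal⟩ := exists_abs_sub_one_le (Fin q) (2 + L * 2) (by positivity)
  obtain ⟨N, hN⟩ := exists_nat_ge (D₁ + D₂ + (1 + 2 * q + 5 * (q : ℝ) ^ 3))
  -- the three terms of `C` serve depth `0`, odd depths and positive even depths
  refine ⟨1 + B * 2 + B * (L * 2), by positivity, N + q, by omega, ?_⟩
  intro d hd α hα hα1 i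
  have : NeZero d := ⟨by omega⟩
  have hd0 : (0 : ℝ) < d := by exact_mod_cast (by omega : 0 < d)
  have hNd : (N : ℝ) ≤ d := by exact_mod_cast (by omega : N ≤ d)
  have hq3 : 0 ≤ 1 + 2 * q + 5 * (q : ℝ) ^ 3 := by positivity
  have hmsg : ∀ (c : ℝ) (n : ℕ) (w : ℝ) (τ : boundary d n → Fin q), c ≤ 2 + L * 2 →
      IsBalanced c (fun i => (q : ℝ) * rootProb d n q w τ i) →
      |rootProb d n q w τ i - 1 / (q : ℝ)| ≤ B * c := by
    intro c n w τ hc h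
    have h1 := hbal c _ hc h i
    have h2 : rootProb d n q w τ i - 1 / (q : ℝ) = (q * rootProb d n q w τ i - 1) / q := by
      field_simp
    rw [h2, abs_div, abs_of_pos hq0]
    exact (div_le_self (abs_nonneg _) hq1).trans h1
  have hstep : ∀ a : ℝ, 0 < a → a ≤ 1 → ∃ D β : ℝ, D₁ ≤ D ∧ D₂ ≤ D ∧
      1 + 2 * q + 5 * (q : ℝ) ^ 3 ≤ D ∧ 0 ≤ β ∧ β ≤ a ∧
      ∀ (n : ℕ) (τ : boundary d (n + 1) → Fin q),
        (fun i => (q : ℝ) * rootProb d (n + 1) q (1 - a * q / (d + 1)) τ i)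
          = treeStep D β fun b k =>
            q * rootProb d n q (1 - a * q / (d + 1)) (childBoundary τ b) k := by
    intro a ha ha1
    have hb : 0 < d + 1 - a := by linarith
    have hdD : (d : ℝ) ≤ (d + 1 - a) / a := by
      rw [le_div_iff₀ ha]
      have : d * a ≤ d := mul_le_of_le_one_right hd0.le ha1
      linarith
    refine ⟨(d + 1 - a) / a, d / ((d + 1 - a) / a), by linarith, by linarith, by linarith,
      by positivity, ?_, fun n τ => mul_rootProb_succ ha ha1 (by omega) τ⟩
    rw [div_div_eq_mul_div, div_le_iff₀ hb, mul_comm]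
    gcongr
    linarith
  have hfirst : ∀ a : ℝ, 0 < a → a ≤ 1 → ∀ τ : boundary d 1 → Fin q,
      IsBalanced (a * 2) (fun i => (q : ℝ) * rootProb d 1 q (1 - a * q / (d + 1)) τ i) := by
    intro a ha ha1 τ
    obtain ⟨D, β, -, -, hD, hβ, hβa, hs⟩ := hstep a ha ha1
    have hw : 0 < 1 - a * q / (d + 1) := by
      have : a * q ≤ q := mul_le_of_le_one_left hq0.le ha1
      have : (q : ℝ) ≤ d := by exact_mod_cast (by omega : q ≤ d)
      rw [sub_pos, div_lt_one (by linarith)]; linarith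
    rw [hs 0 τ]
    simp only [rootProb_zero hw]
    have h1 := isBalanced_treeStep_single (ι := Fin q) (D := D) (β := β)
      (fun b => childBoundary τ b ⟨root d 0, rfl⟩) hβ (by rwa [Fintype.card_fin])
    rw [Fintype.card_fin] at h1
    exact h1.mono (by gcongr)
  constructor
  · have hcrit : criticalWeight q (d + 1) = 1 - 1 * q / (d + 1) := by
      rw [criticalWeight, one_mul, Nat.cast_add, Nat.cast_one]
      apply max_eq_right
      have : (q : ℝ) ≤ d := by exact_mod_cast (by omega : q ≤ d)
      rw [sub_nonneg, div_le_one (by linarith)]; linarith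
    obtain ⟨D, β, hDD₁, hDD₂, -, hβ, hβ1, hs⟩ := hstep 1 one_pos le_rfl
    have hodd : ∀ (k : ℕ) (τ : boundary d (2 * k + 1) → Fin q), IsBalanced (criticalSeq k)
        (fun i => (q : ℝ) * rootProb d (2 * k + 1) q (1 - 1 * q / (d + 1)) τ i) := by
      intro k
      induction k with
      | zero =>
        intro τ
        exact (hfirst 1 one_pos le_rfl τ).mono (by simp [criticalSeq])
      | succ k ih =>
        rw [show 2 * (k + 1) + 1 = 2 * k + 1 + 1 + 1 by ring]
        intro τ
        have h1 := htwo (Fin d) (criticalSeq k) D β _ (criticalSeq_mem k).2 hDD₁ hβ hβ1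
          fun a b => ih (childBoundary (childBoundary τ a) b)
        simp only [← hs] at h1
        refine h1.mono ?_
        exact mul_le_of_le_one_left (criticalSeq_mem (k + 1)).1 hβ1
    have hbound : ∀ (n : ℕ), 1 ≤ n → ∀ τ : boundary d n → Fin q,
        |rootProb d n q (1 - 1 * q / (d + 1)) τ i - 1 / (q : ℝ)|
          ≤ B * ((1 + L) * criticalSeq ((n - 1) / 2)) := by
      intro n hn τ
      obtain ⟨k, rfl | rfl⟩ : ∃ k, n = 2 * k + 1 ∨ n = 2 * k + 1 + 1 :=
        ⟨(n - 1) / 2, by omega⟩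
      · obtain ⟨h0, h2⟩ := criticalSeq_mem k
        have hLk : 0 ≤ L * criticalSeq k := by positivity
        rw [show (2 * k + 1 - 1) / 2 = k by omega]
        refine (hmsg _ _ _ _ (by linarith) (hodd k τ)).trans ?_
        gcongr
        linarith
      · obtain ⟨h0, h2⟩ := criticalSeq_mem k
        have hLk : 0 ≤ L * criticalSeq k := by positivity
        have hLk2 : L * criticalSeq k ≤ L * 2 := by gcongr
        rw [show (2 * k + 1 + 1 - 1) / 2 = k by omega]
        have h1 := hone (Fin d) (criticalSeq k) D β _ h2 hDD₂ hβ
          fun a => hodd k (childBoundary τ a)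
        rw [← hs] at h1
        have h3 := h1.mono (mul_le_of_le_one_left hLk hβ1)
        refine (hmsg _ _ _ _ (by linarith) h3).trans ?_
        gcongr
        linarith
    have hhalf : Tendsto (fun n : ℕ => (n - 1) / 2) atTop atTop :=
      tendsto_atTop_atTop.2 fun b => ⟨2 * b + 1, fun a ha => by omega⟩
    have hlim : Tendsto (fun n : ℕ => B * ((1 + L) * criticalSeq ((n - 1) / 2))) atTop (𝓝 0) := by
      simpa using ((tendsto_criticalSeq.comp hhalf).const_mul (1 + L)).const_mul B
    refine squeeze_zero' (Eventually.of_forall fun n => Real.iSup_nonneg fun τ => abs_nonneg _)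
      ?_ hlim
    filter_upwards [eventually_ge_atTop 1] with n hn
    rw [hcrit]
    refine Real.iSup_le (hbound n hn) ?_
    have := (criticalSeq_mem ((n - 1) / 2)).1
    positivity
  · obtain ⟨D, β, hDD₁, hDD₂, -, hβ, hβα, hs⟩ := hstep α hα hα1.le
    have hβ1 : β ≤ 1 := hβα.trans hα1.le
    have hpow : ∀ k : ℕ, α ^ k * 2 ≤ 2 := fun k =>
      mul_le_of_le_one_left (by norm_num) (pow_le_one₀ hα.le hα1.le)
    have hodd : ∀ (k : ℕ) (τ : boundary d (2 * k + 1) → Fin q), IsBalanced (α ^ (k + 1) * 2)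
        (fun i => (q : ℝ) * rootProb d (2 * k + 1) q (1 - α * q / (d + 1)) τ i) := by
      intro k
      induction k with
      | zero =>
        intro τ
        exact (hfirst α hα hα1.le τ).mono (by simp)
      | succ k ih =>
        rw [show 2 * (k + 1) + 1 = 2 * k + 1 + 1 + 1 by ring]
        intro τ
        have h1 := htwo (Fin d) (α ^ (k + 1) * 2) D β _ (hpow _) hDD₁ hβ hβ1
          fun a b => ih (childBoundary (childBoundary τ a) b)
        simp only [← hs] at h1
        refine h1.mono ?_
        have h3 : 0 ≤ (α ^ (k + 1) * 2) ^ 3 / 36 := by positivity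
        calc β * (α ^ (k + 1) * 2 - (α ^ (k + 1) * 2) ^ 3 / 36) ≤ β * (α ^ (k + 1) * 2) := by
              gcongr; linarith
          _ ≤ α * (α ^ (k + 1) * 2) := by gcongr
          _ = _ := by ring
    intro n τ
    obtain rfl | ⟨k, rfl | rfl⟩ : n = 0 ∨ ∃ k, n = 2 * k + 1 ∨ n = 2 * k + 1 + 1 := by
      rcases Nat.eq_zero_or_pos n with h | h
      · exact Or.inl h
      · exact Or.inr ⟨(n - 1) / 2, by omega⟩
    · have hw : 0 < 1 - α * q / (d + 1) := by
        have : α * q ≤ q := mul_le_of_le_one_left hq0.le hα1.le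
        have : (q : ℝ) ≤ d := by exact_mod_cast (by omega : q ≤ d)
        rw [sub_pos, div_lt_one (by linarith)]; linarith
      have h0 := rootProb_nonneg hw τ i
      have h1 := rootProb_le_one hw τ i
      have h2 : 1 / (q : ℝ) ≤ 1 := by rw [div_le_one hq0]; exact hq1
      have h3 : 0 ≤ 1 / (q : ℝ) := by positivity
      have h4 : 0 ≤ B * 2 + B * (L * 2) := by positivity
      rw [Nat.cast_zero, zero_div, Real.rpow_zero, abs_le]
      constructor <;> linarith
    · have h1 := hmsg _ _ _ _ (by have := hpow (k + 1); have : 0 ≤ L * 2 := by positivity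
                                  linarith) (hodd k τ)
      have h2 : α ^ (k + 1) ≤ α ^ (((2 * k + 1 : ℕ) : ℝ) / 2) := by
        rw [← Real.rpow_natCast]
        apply Real.rpow_le_rpow_of_exponent_ge hα hα1.le
        push_cast
        linarith
      calc _ ≤ B * (α ^ (k + 1) * 2) := h1
        _ = B * 2 * α ^ (k + 1) := by ring
        _ ≤ (1 + B * 2 + B * (L * 2)) * α ^ (((2 * k + 1 : ℕ) : ℝ) / 2) := by
          gcongr
          have : 0 ≤ B * (L * 2) := by positivity
          linarith
    · have h0 : 0 ≤ L * (α ^ (k + 1) * 2) := by positivity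
      have hle : L * (α ^ (k + 1) * 2) ≤ L * 2 := by gcongr; exact hpow _
      have h1 := hone (Fin d) (α ^ (k + 1) * 2) D β _ (hpow _) hDD₂ hβ
        fun a => hodd k (childBoundary τ a)
      rw [← hs] at h1
      have h3 := hmsg _ _ _ _ (by linarith) (h1.mono (mul_le_of_le_one_left h0 hβ1))
      have h2 : α ^ (k + 1) = α ^ (((2 * k + 1 + 1 : ℕ) : ℝ) / 2) := by
        rw [← Real.rpow_natCast]
        congr 1
        push_cast
        ring
      rw [← h2]
      calc _ ≤ B * (L * (α ^ (k + 1) * 2)) := h3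
        _ = B * (L * 2) * α ^ (k + 1) := by ring
        _ ≤ _ := by
          gcongr
          have : 0 ≤ B * 2 := by positivity
          linarith
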